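/- Let $d\ge 1$, $\beta>0$, and let $\phi:[0,\infty)\to[0,+\infty]$ be measurable; particles at $x,y\in\mathbb R^d$ interact through the repulsive, translation-invariant pair potential $\phi(|x-y|)$ (with $e^{-\infty}=0$). Assume that $C(\beta)=\int_{\mathbb R^d}|e^{-\beta\phi(|x|)}-1|\,dx$ is finite and non-zero (so that $\phi(|\cdot|)$ is not a.e. zero). For measurable $\Lambda\subset\mathbb R^d$ with $0<|\Lambda|<\infty$ put $$\Xi_\Lambda(z)=1+\sum_{N\ge1}\frac{z^N}{N!}\int_{\Lambda^N}e^{-\beta\sum_{i<j}\phi(|x_i-x_j|)}\,dx_1\cdots dx_N ,\qquad \beta P_\Lambda(z)=\frac1{|\Lambda|}\ln\Xi_\Lambda(z),$$ where $\ln\Xi_\Lambda$ is the continuous branch, on the disc $|z|\le r^*$ below, that vanishes at $z=0$. Let $\sum_{n\ge1}\frac{b_n(\Lambda)}{n!}z^n$ be the Taylor expansion of $\beta P_\Lambda$ at $z=0$ (the finite-volume cluster expansion), and let $b_n=\lim_{\Lambda\uparrow\mathbb R^d}b_n(\Lambda)$ and $\beta p(z)=\lim_{\Lambda\uparrow\mathbb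 R^d}\beta P_\Lambda(z)$, the limits being taken along van Hove sequences (in particular along Fisher sequences); $\sum_{n\ge1}\frac{b_n}{n!}z^n$ is the infinite-volume cluster expansion. Finally let $$g(n)=\int_{\mathbb R^{dn}}\prod_{i=1}^n\bigl[1-e^{-\beta\phi(|x_i|)}\bigr]\prod_{1\le i<j\le n}e^{-\beta\phi(|x_i-x_j|)}\,dx_1\cdots dx_n,\qquad \Psi(\mu)=1+\sum_{n\ge1}\frac{\mu^n}{n!}g(n).$$ Then $\mu\mapsto\mu/\Psi(\mu)$ attains its maximum over $[0,\infty)$ at exactly one point $\mu^*$. Put $r^*=\max_{\mu\ge0}\mu/\Psi(\mu)=\mu^*/\Psi(\mu^*)$. For every such $\Lambda$ the function $\Xi_\Lambda$ has no zeros in $|z|\le r^*$, so that $\beta P_\Lambda$ is well defined there; the limits $b_n$, and $\beta p(z)$ for $|z|\le r^*$, exist and do not depend on the van Hove sequence; and: (i) The radii of convergence of $\sum_{n\ge1}\frac{b_n(\Lambda)}{n!}z^n$ (for every such $\Lambda$) and of $\sum_{n\ge1}\frac{b_n}{n!}z^n$ are at least $r^*$; for all $|z|\le r^*$ these series converge,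 with sums $\beta P_\Lambda(z)$ and $\beta p(z)$ respectively. (ii) $|\beta P_\Lambda(z)|\le\mu^*$ and $|\beta p(z)|\le\mu^*$ for all $|z|\le r^*$ and every such $\Lambda$. (iii) If $|z|\le r^*$, then the equation $|z|\,\Psi(\mu)=\mu$ has a smallest solution $\mu_z$ in $[0,\infty)$, and $|\beta P_\Lambda(z)|\le\mu_z$ and $|\beta p(z)|\le\mu_z$ for every such $\Lambda$. -/

import Mathlib

open MeasureTheory Filter Topology
open scoped ENNReal

namespace RepulsiveGas

/-- `ℝ^d` with the Euclidean norm and Lebesgue measure. -/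
abbrev Space (d : ℕ) : Type := EuclideanSpace ℝ (Fin d)

/-- The Boltzmann factor `e^{-β u}` of an energy `u ∈ [0, ∞]`, with `e^{-∞} = 0`. -/
noncomputable def boltzmann (β : ℝ) (u : ℝ≥0∞) : ℝ :=
  if u = ⊤ then 0 else Real.exp (-β * u.toReal)

/-- The energy `U_N(x_1, …, x_N) = ∑_{i < j} φ(|x_i - x_j|)`. -/
noncomputable def energy {d N : ℕ} (φ : ℝ → ℝ≥0∞) (x : Fin N → Space d) : ℝ≥0∞ :=
  ∑ i, ∑ j ∈ Finset.Ioi i, φ ‖x i - x j‖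

/-- `C(β) = ∫ |e^{-β φ(x, 0)} - 1| dx`, as an element of `[0, ∞]`. -/
noncomputable def temperConst (d : ℕ) (β : ℝ) (φ : ℝ → ℝ≥0∞) : ℝ≥0∞ :=
  ∫⁻ x : Space d, ENNReal.ofReal |boltzmann β (φ ‖x‖) - 1|

/-- The grand canonical partition function `Ξ_Λ(z)`. -/
noncomputable def partitionFun {d : ℕ} (β : ℝ) (φ : ℝ → ℝ≥0∞) (Λ : Set (Space d)) (z : ℂ) : ℂ :=
  1 + ∑' N : ℕ, z ^ (N + 1) / ((N + 1).factorial : ℂ) *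
    ((∫ x in Set.univ.pi (fun _ : Fin (N + 1) => Λ), boltzmann β (energy φ x) : ℝ) : ℂ)

/-- A finite region: a measurable set of positive and finite volume. -/
structure IsRegion {d : ℕ} (Λ : Set (Space d)) : Prop where
  measurableSet : MeasurableSet Λ
  volume_ne_zero : volume Λ ≠ 0
  volume_ne_top : volume Λ ≠ ⊤

/-- `b_n(Λ)`: the `n`-th derivative at `z = 0` of `|Λ|⁻¹ ln Ξ_Λ(z)`. Since `Ξ_Λ(0) = 1`, near `0` the
principal branch of the logarithm is the right one, and `b_0(Λ) = 0`. -/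
noncomputable def clusterCoeff {d : ℕ} (β : ℝ) (φ : ℝ → ℝ≥0∞) (Λ : Set (Space d)) (n : ℕ) : ℂ :=
  iteratedDeriv n (fun z : ℂ => (volume.real Λ : ℂ)⁻¹ * Complex.log (partitionFun β φ Λ z)) 0

/-- Radius of convergence of the power series `∑ (b_n / n!) z^n`. -/
noncomputable def expansionRadius (b : ℕ → ℂ) : ℝ≥0∞ :=
  (FormalMultilinearSeries.ofScalars ℂ (fun n : ℕ => b n / (n.factorial : ℂ))).radius

/-- `P` is the finite-volume pressure `z ↦ β P_Λ(z) = |Λ|⁻¹ ln Ξ_Λ(z)` on the disc `|z| ≤ R`, where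
`ln Ξ_Λ` is the continuous branch of the logarithm with `ln Ξ_Λ(0) = 0`. These conditions
determine `P` on the disc. -/
structure IsFinitePressure {d : ℕ} (β : ℝ) (φ : ℝ → ℝ≥0∞) (Λ : Set (Space d)) (R : ℝ)
    (P : ℂ → ℂ) : Prop where
  continuousOn : ContinuousOn P (Metric.closedBall 0 R)
  map_zero : P 0 = 0
  exp_eq : ∀ z ∈ Metric.closedBall (0 : ℂ) R,
    Complex.exp ((volume.real Λ : ℂ) * P z) = partitionFun β φ Λ z

/-- Van Hove convergence `Λ_k ↑ ℝ^d`: the volumes tend to infinity and, for every `h > 0`, the volume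
of the set of points at distance at most `h` from the boundary of `Λ_k` is negligible with respect
to the volume of `Λ_k`. Sequences tending to infinity in the sense of Fisher have this property. -/
structure IsVanHove {d : ℕ} (Λ : ℕ → Set (Space d)) : Prop where
  isRegion : ∀ k, IsRegion (Λ k)
  volume_tendsto : Tendsto (fun k => volume (Λ k)) atTop (𝓝 ⊤)
  boundary_tendsto : ∀ h : ℝ, 0 < h →
    Tendsto (fun k => volume (Metric.cthickening h (frontier (Λ k))) / volume (Λ k)) atTop (𝓝 0)

/-- `φ_n(0; x_1, …, x_n) = ∏_i (1 - e^{-β φ(0, x_i)}) ∏_{i < j} e^{-β φ(x_i, x_j)}`. -/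
noncomputable def vertexWeight {d n : ℕ} (β : ℝ) (φ : ℝ → ℝ≥0∞) (x : Fin n → Space d) : ℝ :=
  (∏ i, (1 - boltzmann β (φ ‖x i‖))) *
    ∏ i, ∏ j ∈ Finset.Ioi i, boltzmann β (φ ‖x i - x j‖)

/-- `g(n) = ∫ φ_n(0; x_1, …, x_n) dx_1 ⋯ dx_n`. -/
noncomputable def vertexIntegral (d : ℕ) (β : ℝ) (φ : ℝ → ℝ≥0∞) (n : ℕ) : ℝ :=
  ∫ x : Fin n → Space d, vertexWeight β φ x

/-- The vertex sum `Ψ(μ) = 1 + ∑_{n ≥ 1} (μ^n / n!) g(n)`. -/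
noncomputable def vertexSum (d : ℕ) (β : ℝ) (φ : ℝ → ℝ≥0∞) (μ : ℝ) : ℝ :=
  1 + ∑' n : ℕ, μ ^ (n + 1) / ((n + 1).factorial : ℝ) * vertexIntegral d β φ (n + 1)

/-- `m` is a maximizer of `μ ↦ μ / Ψ(μ)` on `[0, ∞)`. -/
def IsArgmax (d : ℕ) (β : ℝ) (φ : ℝ → ℝ≥0∞) (m : ℝ) : Prop :=
  0 ≤ m ∧ ∀ μ : ℝ, 0 ≤ μ → μ / vertexSum d β φ μ ≤ m / vertexSum d β φ m

/-- `m` is the smallest solution in `[0, ∞)` of the fixed-point equation `|z| Ψ(m) = m`. -/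
def IsSmallestFixedPoint (d : ℕ) (β : ℝ) (φ : ℝ → ℝ≥0∞) (z : ℂ) (m : ℝ) : Prop :=
  IsLeast {μ : ℝ | 0 ≤ μ ∧ ‖z‖ * vertexSum d β φ μ = μ} m

end RepulsiveGas

/-! ### Configuration integrals with a position-dependent activity. -/

namespace RepulsiveGas

/-! Write `Ξ(t)` for the partition function with position-dependent activity `t`, and evaluate it at
`-X t` as a formal power series in `X`. A particle at `x` multiplies the activity by `e(· - x)`; the
quantity to control is the ratio of `Ξ` with and without this particle (`ratioSeries`). The screened
activity is `t` minus the nonnegative `defect` `t (1 - e(· - x))`. Expanding in the number `n` of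
defect particles gives the Kirkwood-Salsburg equation `coeff_ratioSeries`. At activity `-X` the
signs of this expansion cancel, and each normalized `n`-particle integral is an iterated integral of
products of ratios, with activities screened by the particles already placed
(`coeff_mixedRatio_succ`). As `e` lies in `[0, 1]`, induction on the degree shows that all
coefficients of all ratios are nonnegative. Since the factors `e` between the defect particles are
kept, and the defect is at most a translate of `1 - e`, the coefficients are bounded by those of the
formal solution `M` of `M = Ψ(X M)`, uniformly in `t` and `x` (`coeff_ratioSeries_mem`). Whenever `r
Ψ(μ) ≤ μ`, the partial sums of `r M(r)` are at most `μ` (`sum_treeCoeff_le`). The derivative of `ln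
Ξ_Λ` is the integral over `Λ` of the ratio at `X = -z` (`configInt_succ_eq`), so after division by
`|Λ|` its Taylor coefficients are bounded by those of `M`, whatever `Λ` is. Integrating the series
gives a function that converges on the closed disc and satisfies every bound; a differential
equation shows that the exponential of `|Λ|` times it is `Ξ_Λ`, which therefore has no zeros there
(`isFinitePressure_pressure`). For the infinite-volume limit, dominated convergence makes each
coefficient of the ratio at `0` converge when the regions contain larger and larger balls
(`exists_limit_coeff_ratioSeries`). By translation the same holds at every point far from the
boundary of `Λ`, and the van Hove condition makes the remaining points negligible
(`tendsto_average_logDerivCoeff`). The uniform domination carries the convergence over to the sums.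
Uniqueness of the maximizer comes from strict convexity of `Ψ`, which rests on `g(2) > 0`
(`configInt_two_pos`). -/

/-- A pair interaction factor `e(x - y) = e^{-β φ(|x - y|)}`. -/
structure IsPairFactor {d : ℕ} (e : Space d → ℝ) : Prop where
  measurable : Measurable e
  nonneg : ∀ x, 0 ≤ e x
  le_one : ∀ x, e x ≤ 1
  even : ∀ x, e (-x) = e x

/-- An integrable, position dependent activity with values in `[0, 1]`. -/
structure IsActivity {d : ℕ} (t : Space d → ℝ) : Prop where
  measurable : Measurable t
  nonneg : ∀ x, 0 ≤ t x
  le_one : ∀ x, t x ≤ 1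
  integrable : Integrable t

/-- The activity `t` in the presence of a particle at `y`. -/
def screen {d : ℕ} (e t : Space d → ℝ) (y : Space d) : Space d → ℝ := fun w => t w * e (w - y)

/-- The `N`-particle configuration integral with activity `t`, as an iterated integral. -/
noncomputable def configInt {d : ℕ} (e : Space d → ℝ) : ℕ → (Space d → ℝ) → ℝ
  | 0, _ => 1
  | N + 1, t => ∫ y, t y * configInt e N (screen e t y)

/-- The configuration integral of `n` particles with activity `b` and `m` particles with
activity `a`. -/
noncomputable def mixedInt {d : ℕ} (e : Space d → ℝ) (m : ℕ) :
    ℕ → (Space d → ℝ) → (Space d → ℝ) → ℝ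
  | 0, _, a => configInt e m a
  | n + 1, b, a => ∫ y, b y * mixedInt e m n (screen e b y) (screen e a y)

variable {d : ℕ} {e : Space d → ℝ}

lemma IsActivity.screen {t : Space d → ℝ} (ht : IsActivity t) (he : IsPairFactor e) (y : Space d) :
    IsActivity (screen e t y) := by
  have hm : Measurable (RepulsiveGas.screen e t y) :=
    ht.measurable.mul (he.measurable.comp (measurable_id.sub_const y))
  refine ⟨hm, fun x => mul_nonneg (ht.nonneg x) (he.nonneg _),
    fun x => mul_le_one₀ (ht.le_one x) (he.nonneg _) (he.le_one _), ?_⟩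
  refine ht.integrable.mono' hm.aestronglyMeasurable (.of_forall fun x => ?_)
  rw [RepulsiveGas.screen, Real.norm_of_nonneg (mul_nonneg (ht.nonneg x) (he.nonneg _))]
  exact mul_le_of_le_one_right (ht.nonneg x) (he.le_one _)

lemma integral_screen_le {t : Space d → ℝ} (ht : IsActivity t) (he : IsPairFactor e)
    (y : Space d) : ∫ w, screen e t y w ≤ ∫ w, t w :=
  integral_mono (ht.screen he y).integrable ht.integrable
    fun w => mul_le_of_le_one_right (ht.nonneg w) (he.le_one _)

lemma integral_nonneg_activity {t : Space d → ℝ} (ht : IsActivity t) : 0 ≤ ∫ w, t w :=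
  integral_nonneg ht.nonneg

lemma screen_comm (t : Space d → ℝ) (y w : Space d) :
    screen e (screen e t y) w = screen e (screen e t w) y := by
  funext u; simp only [screen]; ring

lemma IsActivity.integrable_mul {b h : Space d → ℝ} (hb : IsActivity b) (hh : Measurable h)
    {C : ℝ} (hC : ∀ y, |h y| ≤ C) : Integrable (fun y => b y * h y) := by
  refine (hb.integrable.mul_const C).mono' (hb.measurable.mul hh).aestronglyMeasurable
    (.of_forall fun y => ?_)
  rw [Real.norm_eq_abs, abs_mul, abs_of_nonneg (hb.nonneg y)]
  exact mul_le_mul_of_nonneg_left (hC y) (hb.nonneg y)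

section Measurability
variable {Ω : Type} [MeasurableSpace Ω]

lemma measurable_screen_param (he : IsPairFactor e) {T : Ω → Space d → ℝ}
    (hT : Measurable (Function.uncurry T)) :
    Measurable (Function.uncurry fun (p : Ω × Space d) w => screen e (T p.1) p.2 w) := by
  have h1 : Measurable fun q : (Ω × Space d) × Space d => T q.1.1 q.2 :=
    hT.comp (f := fun q : (Ω × Space d) × Space d => (q.1.1, q.2)) (by fun_prop)
  have h2 : Measurable fun q : (Ω × Space d) × Space d => e (q.2 - q.1.2) :=
    he.measurable.comp (by fun_prop)
  exact h1.mul h2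

/-- The parameter space is quantified after the induction variable: integrating out one particle
replaces `Ω` by `Ω × Space d`. -/
lemma measurable_configInt_param (he : IsPairFactor e) (N : ℕ) :
    ∀ {Ω : Type} [MeasurableSpace Ω] {T : Ω → Space d → ℝ}, Measurable (Function.uncurry T) →
      Measurable fun ω => configInt e N (T ω) := by
  induction N with
  | zero => intro Ω _ T _; exact measurable_const
  | succ N ih =>
    intro Ω _ T hT
    have h := hT.mul (ih (measurable_screen_param he hT))
    exact (h.stronglyMeasurable.integral_prod_right' (ν := volume)).measurable

lemma measurable_mixedInt_param (he : IsPairFactor e) (m n : ℕ) :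
    ∀ {Ω : Type} [MeasurableSpace Ω] {B T : Ω → Space d → ℝ}, Measurable (Function.uncurry B) →
      Measurable (Function.uncurry T) → Measurable fun ω => mixedInt e m n (B ω) (T ω) := by
  induction n with
  | zero => intro Ω _ B T _ hT; exact measurable_configInt_param he m hT
  | succ n ih =>
    intro Ω _ B T hB hT
    have h := hB.mul (ih (measurable_screen_param he hB) (measurable_screen_param he hT))
    exact (h.stronglyMeasurable.integral_prod_right' (ν := volume)).measurable

end Measurability

lemma measurable_uncurry_screen (he : IsPairFactor e) {t : Space d → ℝ} (ht : Measurable t) :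
    Measurable (Function.uncurry (screen e t)) := by
  have h1 : Measurable fun q : Space d × Space d => t q.2 := ht.comp measurable_snd
  have h2 : Measurable fun q : Space d × Space d => e (q.2 - q.1) :=
    he.measurable.comp (by fun_prop)
  exact h1.mul h2

lemma measurable_mixedInt_screen (he : IsPairFactor e) (m n : ℕ) {b t : Space d → ℝ}
    (hb : Measurable b) (ht : Measurable t) :
    Measurable fun y => mixedInt e m n (screen e b y) (screen e t y) :=
  measurable_mixedInt_param he m n (measurable_uncurry_screen he hb)
    (measurable_uncurry_screen he ht)

lemma configInt_nonneg (he : IsPairFactor e) (N : ℕ) {t : Space d → ℝ} (ht : IsActivity t) :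
    0 ≤ configInt e N t := by
  induction N generalizing t with
  | zero => exact zero_le_one
  | succ N ih => exact integral_nonneg fun y => mul_nonneg (ht.nonneg y) (ih (ht.screen he y))

lemma configInt_le (he : IsPairFactor e) (N : ℕ) {t : Space d → ℝ} (ht : IsActivity t) :
    configInt e N t ≤ (∫ w, t w) ^ N := by
  induction N generalizing t with
  | zero => exact le_of_eq (pow_zero _).symm
  | succ N ih =>
    have hle : ∀ y, configInt e N (screen e t y) ≤ (∫ w, t w) ^ N := fun y =>
      (ih (ht.screen he y)).trans (pow_le_pow_left₀ (integral_nonneg_activity (ht.screen he y))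
        (integral_screen_le ht he y) N)
    have h := integral_mono_of_nonneg (μ := volume) (g := fun y => t y * (∫ w, t w) ^ N)
      (.of_forall fun y => mul_nonneg (ht.nonneg y) (configInt_nonneg he N (ht.screen he y)))
      (ht.integrable.mul_const _)
      (.of_forall fun y => mul_le_mul_of_nonneg_left (hle y) (ht.nonneg y))
    rw [integral_mul_const] at h
    rw [pow_succ']
    exact h

lemma mixedInt_nonneg (he : IsPairFactor e) (m n : ℕ) {b t : Space d → ℝ} (hb : IsActivity b)
    (ht : IsActivity t) : 0 ≤ mixedInt e m n b t := by
  induction n generalizing b t with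
  | zero => exact configInt_nonneg he m ht
  | succ n ih =>
    exact integral_nonneg fun y => mul_nonneg (hb.nonneg y) (ih (hb.screen he y) (ht.screen he y))

lemma mixedInt_le (he : IsPairFactor e) (m n : ℕ) {b t : Space d → ℝ} (hb : IsActivity b)
    (ht : IsActivity t) : mixedInt e m n b t ≤ (∫ w, b w) ^ n * (∫ w, t w) ^ m := by
  induction n generalizing b t with
  | zero => simpa [mixedInt] using configInt_le he m ht
  | succ n ih =>
    have hle : ∀ y, mixedInt e m n (screen e b y) (screen e t y) ≤
        (∫ w, b w) ^ n * (∫ w, t w) ^ m := fun y =>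
      (ih (hb.screen he y) (ht.screen he y)).trans
        (mul_le_mul
          (pow_le_pow_left₀ (integral_nonneg_activity (hb.screen he y)) (integral_screen_le hb he y) n)
          (pow_le_pow_left₀ (integral_nonneg_activity (ht.screen he y)) (integral_screen_le ht he y) m)
          (pow_nonneg (integral_nonneg_activity (ht.screen he y)) _)
          (pow_nonneg (integral_nonneg_activity hb) _))
    have h := integral_mono_of_nonneg (μ := volume)
      (g := fun y => b y * ((∫ w, b w) ^ n * (∫ w, t w) ^ m))
      (.of_forall fun y => mul_nonneg (hb.nonneg y)
        (mixedInt_nonneg he m n (hb.screen he y) (ht.screen he y)))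
      (hb.integrable.mul_const _)
      (.of_forall fun y => mul_le_mul_of_nonneg_left (hle y) (hb.nonneg y))
    rw [integral_mul_const] at h
    rw [pow_succ', mul_assoc]
    exact h

lemma mixedInt_screen_abs_le (he : IsPairFactor e) (m n : ℕ) {b t : Space d → ℝ}
    (hb : IsActivity b) (ht : IsActivity t) (y : Space d) :
    |mixedInt e m n (screen e b y) (screen e t y)| ≤ (∫ w, b w) ^ n * (∫ w, t w) ^ m := by
  rw [abs_of_nonneg (mixedInt_nonneg he m n (hb.screen he y) (ht.screen he y))]
  refine (mixedInt_le he m n (hb.screen he y) (ht.screen he y)).trans (mul_le_mul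
    (pow_le_pow_left₀ (integral_nonneg_activity (hb.screen he y)) (integral_screen_le hb he y) n)
    (pow_le_pow_left₀ (integral_nonneg_activity (ht.screen he y)) (integral_screen_le ht he y) m)
    (pow_nonneg (integral_nonneg_activity (ht.screen he y)) _)
    (pow_nonneg (integral_nonneg_activity hb) _))

lemma integrable_mul_mixedInt (he : IsPairFactor e) (m n : ℕ) {f b t : Space d → ℝ}
    (hf : IsActivity f) (hb : IsActivity b) (ht : IsActivity t) :
    Integrable fun y => f y * mixedInt e m n (screen e b y) (screen e t y) :=
  hf.integrable_mul (measurable_mixedInt_screen he m n hb.measurable ht.measurable)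
    (mixedInt_screen_abs_le he m n hb ht)

lemma integrable_mul_configInt (he : IsPairFactor e) (m : ℕ) {f t : Space d → ℝ}
    (hf : IsActivity f) (ht : IsActivity t) :
    Integrable fun y => f y * configInt e m (screen e t y) :=
  integrable_mul_mixedInt he m 0 hf ht ht

lemma configInt_mono (he : IsPairFactor e) (N : ℕ) {s t : Space d → ℝ} (hs : IsActivity s)
    (ht : IsActivity t) (hst : ∀ x, s x ≤ t x) : configInt e N s ≤ configInt e N t := by
  induction N generalizing s t with
  | zero => exact le_rfl
  | succ N ih =>
    refine integral_mono (integrable_mul_configInt he N hs hs)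
      (integrable_mul_configInt he N ht ht) fun y => ?_
    exact mul_le_mul (hst y) (ih (hs.screen he y) (ht.screen he y)
      fun x => mul_le_mul_of_nonneg_right (hst x) (he.nonneg _))
      (configInt_nonneg he N (hs.screen he y)) (ht.nonneg y)

lemma screen_translate (t : Space d → ℝ) (a y : Space d) :
    screen e (fun w => t (w + a)) y = fun w => screen e t (y + a) (w + a) := by
  funext w; simp only [screen]; congr 2; abel

lemma configInt_translate (N : ℕ) (t : Space d → ℝ) (a : Space d) :
    configInt e N (fun w => t (w + a)) = configInt e N t := by
  induction N generalizing t with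
  | zero => rfl
  | succ N ih =>
    simp only [configInt, screen_translate, ih]
    exact integral_add_right_eq_self (fun y => t y * configInt e N (screen e t y)) a

/-- `mixedInt` integrates the `b`-particles outermost, so a `t`-particle placed outside has to be
moved past all of them; each exchange is Fubini together with the symmetry of `e`. -/
lemma integral_mul_mixedInt (he : IsPairFactor e) (m n : ℕ) {b t : Space d → ℝ}
    (hb : IsActivity b) (ht : IsActivity t) :
    ∫ y, t y * mixedInt e m n (screen e b y) (screen e t y) = mixedInt e (m + 1) n b t := by
  induction n generalizing b t with
  | zero => rfl
  | succ n ih =>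
    simp only [mixedInt]
    have hswap : ∫ y, t y * ∫ w, screen e b y w * mixedInt e m n (screen e (screen e b y) w)
          (screen e (screen e t y) w) =
        ∫ w, ∫ y, t y * (screen e b y w * mixedInt e m n (screen e (screen e b y) w)
          (screen e (screen e t y) w)) := by
      simp_rw [← integral_const_mul]
      refine integral_integral_swap ?_
      have hmeas : Measurable fun q : Space d × Space d =>
          mixedInt e m n (screen e (screen e b q.1) q.2) (screen e (screen e t q.1) q.2) :=
        measurable_mixedInt_param he m n
          (measurable_screen_param he (measurable_uncurry_screen he hb.measurable))
          (measurable_screen_param he (measurable_uncurry_screen he ht.measurable))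
      refine ((ht.integrable.mul_prod hb.integrable).mul_const
        ((∫ w, b w) ^ n * (∫ w, t w) ^ m)).mono' ?_ (.of_forall fun q => ?_)
      · exact ((ht.measurable.comp measurable_fst).mul
          ((measurable_uncurry_screen he hb.measurable).mul hmeas)).aestronglyMeasurable
      · have h0 := mixedInt_screen_abs_le he m n (hb.screen he q.1) (ht.screen he q.1) q.2
        have h1 : (∫ w, screen e b q.1 w) ^ n * (∫ w, screen e t q.1 w) ^ m ≤
            (∫ w, b w) ^ n * (∫ w, t w) ^ m := mul_le_mul
          (pow_le_pow_left₀ (integral_nonneg_activity (hb.screen he _)) (integral_screen_le hb he _) n)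
          (pow_le_pow_left₀ (integral_nonneg_activity (ht.screen he _)) (integral_screen_le ht he _) m)
          (pow_nonneg (integral_nonneg_activity (ht.screen he _)) _)
          (pow_nonneg (integral_nonneg_activity hb) _)
        simp only [Function.uncurry, Real.norm_eq_abs, abs_mul]
        rw [abs_of_nonneg (ht.nonneg _), abs_of_nonneg ((hb.screen he q.1).nonneg _), mul_assoc]
        refine mul_le_mul_of_nonneg_left ?_ (ht.nonneg _)
        exact mul_le_mul (mul_le_of_le_one_right (hb.nonneg _) (he.le_one _)) (h0.trans h1)
          (abs_nonneg _) (hb.nonneg _)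
    rw [hswap]
    congr 1; funext w
    rw [← ih (hb.screen he w) (ht.screen he w), ← integral_const_mul]
    congr 1; funext y
    rw [screen_comm b, screen_comm t]
    simp only [screen]
    -- After the exchange the interaction of `y` and `w` appears as seen from the other particle,
    -- hence the evenness of `e`.
    rw [← he.even (w - y), neg_sub]
    ring

lemma screen_sub (a b : Space d → ℝ) (y : Space d) :
    screen e (fun w => a w - b w) y = fun w => screen e a y w - screen e b y w := by
  funext w; simp only [screen]; ring

/-- The binomial theorem: the integrand is symmetric, so after multiplying out the factors `a - b`
only the number `n` of particles that receive `b` matters. The induction removes one particle and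
uses Pascal's rule. The difference `a - b` itself need not be an activity. -/
lemma configInt_sub (he : IsPairFactor e) (N : ℕ) {a b : Space d → ℝ} (ha : IsActivity a)
    (hb : IsActivity b) : configInt e N (fun w => a w - b w) =
      ∑ n ∈ Finset.range (N + 1), (-1) ^ n * (N.choose n : ℝ) * mixedInt e (N - n) n b a := by
  induction N generalizing a b with
  | zero => simp [configInt, mixedInt]
  | succ N ih =>
    have hstep : configInt e (N + 1) (fun w => a w - b w) =
        (∑ n ∈ Finset.range (N + 1), (-1) ^ n * (N.choose n : ℝ) * mixedInt e (N + 1 - n) n b a) +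
        ∑ n ∈ Finset.range (N + 1),
          (-1) ^ (n + 1) * (N.choose n : ℝ) * mixedInt e (N - n) (n + 1) b a := by
      have h1 : ∀ n ∈ Finset.range (N + 1), (-1) ^ n * (N.choose n : ℝ) *
          mixedInt e (N + 1 - n) n b a = ∫ y, (-1) ^ n * (N.choose n : ℝ) *
            (a y * mixedInt e (N - n) n (screen e b y) (screen e a y)) := by
        intro n hn
        rw [integral_const_mul, integral_mul_mixedInt he _ _ hb ha,
          Nat.sub_add_comm (Finset.mem_range_succ_iff.1 hn)]
      have h2 : ∀ n, (-1) ^ (n + 1) * (N.choose n : ℝ) * mixedInt e (N - n) (n + 1) b a =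
          ∫ y, (-1) ^ (n + 1) * (N.choose n : ℝ) *
            (b y * mixedInt e (N - n) n (screen e b y) (screen e a y)) := by
        intro n; rw [integral_const_mul]; rfl
      have i1 : ∀ n ∈ Finset.range (N + 1), Integrable fun y => (-1) ^ n * (N.choose n : ℝ) *
            (a y * mixedInt e (N - n) n (screen e b y) (screen e a y)) :=
        fun n _ => (integrable_mul_mixedInt he _ _ ha hb ha).const_mul _
      have i2 : ∀ n ∈ Finset.range (N + 1), Integrable fun y => (-1) ^ (n + 1) * (N.choose n : ℝ) *
            (b y * mixedInt e (N - n) n (screen e b y) (screen e a y)) :=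
        fun n _ => (integrable_mul_mixedInt he _ _ hb hb ha).const_mul _
      rw [Finset.sum_congr rfl h1, Finset.sum_congr rfl fun n _ => h2 n,
        ← integral_finsetSum _ i1, ← integral_finsetSum _ i2,
        ← integral_add (integrable_finsetSum _ i1) (integrable_finsetSum _ i2)]
      simp only [configInt]
      congr 1; funext y
      rw [screen_sub, ih (ha.screen he y) (hb.screen he y), ← Finset.sum_add_distrib,
        Finset.mul_sum]
      refine Finset.sum_congr rfl fun n _ => ?_
      ring
    rw [hstep, Finset.sum_range_succ' _ (N + 1), Finset.sum_range_succ' _ N,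
      Finset.sum_range_succ _ N]
    rw [Finset.sum_range_succ (fun n => (-1) ^ (n + 1) * ((N + 1).choose (n + 1) : ℝ) *
      mixedInt e (N + 1 - (n + 1)) (n + 1) b a)]
    have h3 : ∑ n ∈ Finset.range N, (-1) ^ (n + 1) * ((N + 1).choose (n + 1) : ℝ) *
        mixedInt e (N + 1 - (n + 1)) (n + 1) b a =
        ∑ n ∈ Finset.range N, (-1) ^ (n + 1) * (N.choose (n + 1) : ℝ) *
          mixedInt e (N + 1 - (n + 1)) (n + 1) b a +
        ∑ n ∈ Finset.range N, (-1) ^ (n + 1) * (N.choose n : ℝ) *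
          mixedInt e (N - n) (n + 1) b a := by
      rw [← Finset.sum_add_distrib]
      refine Finset.sum_congr rfl fun n _ => ?_
      rw [Nat.choose_succ_succ, Nat.add_sub_add_right]
      push_cast; ring
    rw [h3]
    simp
    ring

end RepulsiveGas

/-! ### Kirkwood-Salsburg recursion for formal ratios and domination by the tree series. -/

namespace RepulsiveGas
variable {d : ℕ} {e : Space d → ℝ}

/-- The partition function with activity `-X t`, as a formal power series in `X`. -/
noncomputable def partitionSeries (e t : Space d → ℝ) : PowerSeries ℝ :=
  PowerSeries.mk fun N => (-1) ^ N / (N.factorial : ℝ) * configInt e N t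

/-- The formal power series of the integrals of `n` particles with activity `b` together with
arbitrarily many particles with activity `-X t`. -/
noncomputable def mixedSeries (e : Space d → ℝ) (n : ℕ) (b t : Space d → ℝ) : PowerSeries ℝ :=
  PowerSeries.mk fun m => (-1) ^ m / (m.factorial : ℝ) * mixedInt e m n b t

/-- The ratio of the partition functions with and without a particle at `x`. -/
noncomputable def ratioSeries (e t : Space d → ℝ) (x : Space d) : PowerSeries ℝ :=
  partitionSeries e (screen e t x) * (partitionSeries e t)⁻¹

/-- The normalized `mixedSeries`. -/
noncomputable def mixedRatio (e : Space d → ℝ) (n : ℕ) (b t : Space d → ℝ) : PowerSeries ℝ :=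
  mixedSeries e n b t * (partitionSeries e t)⁻¹

/-- The part of the activity `t` that a particle at `x` removes. -/
def defect (e t : Space d → ℝ) (x : Space d) : Space d → ℝ := fun w => t w * (1 - e (w - x))

lemma IsActivity.defect {t : Space d → ℝ} (ht : IsActivity t) (he : IsPairFactor e) (x : Space d) :
    IsActivity (defect e t x) := by
  have h0 : ∀ w, 0 ≤ 1 - e w := fun w => sub_nonneg.2 (he.le_one w)
  have h1 : ∀ w, 1 - e w ≤ 1 := fun w => sub_le_self _ (he.nonneg w)
  have hm : Measurable fun w => 1 - e (w - x) :=
    measurable_const.sub (he.measurable.comp (measurable_id.sub_const x))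
  exact ⟨ht.measurable.mul hm, fun w => mul_nonneg (ht.nonneg w) (h0 _),
    fun w => mul_le_one₀ (ht.le_one w) (h0 _) (h1 _),
    ht.integrable_mul (C := 1) hm fun w => by rw [abs_of_nonneg (h0 _)]; exact h1 _⟩

lemma partitionSeries_mul_inv (t : Space d → ℝ) :
    partitionSeries e t * (partitionSeries e t)⁻¹ = 1 := by
  refine PowerSeries.mul_inv_cancel _ ?_
  rw [← PowerSeries.coeff_zero_eq_constantCoeff_apply]
  simp [partitionSeries, configInt]

lemma ratioSeries_mul (t : Space d → ℝ) (x : Space d) :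
    ratioSeries e t x * partitionSeries e t = partitionSeries e (screen e t x) := by
  rw [ratioSeries, mul_assoc, mul_comm _ (partitionSeries e t), partitionSeries_mul_inv, mul_one]

lemma mixedRatio_zero (b t : Space d → ℝ) : mixedRatio e 0 b t = 1 :=
  partitionSeries_mul_inv t

/-- The partition function of the screened activity cancels, being the numerator of one factor and
the denominator of the other. This turns the recursion of `mixedInt` into one for normalized
quantities. -/
lemma ratioSeries_mul_mixedRatio (n : ℕ) (b t : Space d → ℝ) (y : Space d) :
    ratioSeries e t y * mixedRatio e n (screen e b y) (screen e t y) =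
      mixedSeries e n (screen e b y) (screen e t y) * (partitionSeries e t)⁻¹ := by
  rw [ratioSeries, mixedRatio]
  linear_combination mixedSeries e n (screen e b y) (screen e t y) * (partitionSeries e t)⁻¹ *
    partitionSeries_mul_inv (e := e) (screen e t y)

/-- Working coefficient by coefficient, only a finite sum has to be exchanged with the integral, so
no convergence in `X` is needed. Integrability and the formula come from the same finite
decomposition. -/
lemma coeff_mixedRatio_succ_aux (he : IsPairFactor e) (m n : ℕ) {b t : Space d → ℝ}
    (hb : IsActivity b) (ht : IsActivity t) :
    Integrable (fun y => b y * PowerSeries.coeff m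
      (ratioSeries e t y * mixedRatio e n (screen e b y) (screen e t y))) ∧
    PowerSeries.coeff m (mixedRatio e (n + 1) b t) = ∫ y, b y * PowerSeries.coeff m
      (ratioSeries e t y * mixedRatio e n (screen e b y) (screen e t y)) := by
  have h : ∀ y, b y * PowerSeries.coeff m
      (ratioSeries e t y * mixedRatio e n (screen e b y) (screen e t y)) =
      ∑ p ∈ Finset.HasAntidiagonal.antidiagonal m, (-1) ^ p.1 / (p.1.factorial : ℝ) *
        PowerSeries.coeff p.2 (partitionSeries e t)⁻¹ *
        (b y * mixedInt e p.1 n (screen e b y) (screen e t y)) := by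
    intro y
    rw [ratioSeries_mul_mixedRatio, PowerSeries.coeff_mul, Finset.mul_sum]
    refine Finset.sum_congr rfl fun p _ => ?_
    rw [mixedSeries, PowerSeries.coeff_mk]; ring
  have hi : ∀ p ∈ Finset.HasAntidiagonal.antidiagonal m, Integrable fun y => (-1) ^ p.1 / (p.1.factorial : ℝ) *
        PowerSeries.coeff p.2 (partitionSeries e t)⁻¹ *
        (b y * mixedInt e p.1 n (screen e b y) (screen e t y)) :=
    fun p _ => (integrable_mul_mixedInt he _ _ hb hb ht).const_mul _
  simp_rw [h]
  refine ⟨integrable_finsetSum _ hi, ?_⟩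
  rw [integral_finsetSum _ hi, mixedRatio, PowerSeries.coeff_mul]
  refine Finset.sum_congr rfl fun p _ => ?_
  rw [integral_const_mul, mixedSeries, PowerSeries.coeff_mk, mixedInt]
  ring

lemma coeff_mixedRatio_succ (he : IsPairFactor e) (m n : ℕ) {b t : Space d → ℝ}
    (hb : IsActivity b) (ht : IsActivity t) :
    PowerSeries.coeff m (mixedRatio e (n + 1) b t) = ∫ y, b y * PowerSeries.coeff m
      (ratioSeries e t y * mixedRatio e n (screen e b y) (screen e t y)) :=
  (coeff_mixedRatio_succ_aux he m n hb ht).2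

/-- This is where the signs disappear: `(-1) ^ n` from expanding `t - defect` meets `(-1) ^ N` from
the activity `-X`, leaving `(-1) ^ (N - n)`, which belongs to `mixedSeries`. -/
lemma coeff_partitionSeries_screen (he : IsPairFactor e) (N : ℕ) {t : Space d → ℝ}
    (ht : IsActivity t) (x : Space d) :
    PowerSeries.coeff N (partitionSeries e (screen e t x)) =
      ∑ n ∈ Finset.range (N + 1), 1 / (n.factorial : ℝ) *
        PowerSeries.coeff (N - n) (mixedSeries e n (defect e t x) t) := by
  have hs : screen e t x = fun w => t w - defect e t x w := by
    funext w; simp only [screen, defect]; ring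
  rw [partitionSeries, PowerSeries.coeff_mk, hs, configInt_sub he N ht (ht.defect he x),
    Finset.mul_sum]
  refine Finset.sum_congr rfl fun n hn => ?_
  have hn' : n ≤ N := Finset.mem_range_succ_iff.1 hn
  obtain ⟨m, rfl⟩ := Nat.exists_eq_add_of_le hn'
  rw [mixedSeries, PowerSeries.coeff_mk, Nat.add_sub_cancel_left, Nat.cast_add_choose]
  have h1 := Nat.factorial_ne_zero (n + m)
  have h2 := Nat.factorial_ne_zero n
  have h3 := Nat.factorial_ne_zero m
  have h4 : ((-1 : ℝ) ^ n) * (-1) ^ n = 1 := by rw [← mul_pow]; simp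
  field_simp
  rw [pow_add]
  linear_combination (-1) ^ m * mixedInt e m n (defect e t x) t * h4

lemma coeff_mul_congr {A B C : PowerSeries ℝ} {N : ℕ}
    (h : ∀ n ≤ N, PowerSeries.coeff n A = PowerSeries.coeff n B) :
    PowerSeries.coeff N (A * C) = PowerSeries.coeff N (B * C) := by
  rw [PowerSeries.coeff_mul, PowerSeries.coeff_mul]
  exact Finset.sum_congr rfl fun p hp => by rw [h _ (Finset.HasAntidiagonal.antidiagonal.fst_le hp)]

/-- The Kirkwood-Salsburg equation. -/
lemma coeff_ratioSeries (he : IsPairFactor e) (N : ℕ) {t : Space d → ℝ}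
    (ht : IsActivity t) (x : Space d) :
    PowerSeries.coeff N (ratioSeries e t x) =
      ∑ n ∈ Finset.range (N + 1), 1 / (n.factorial : ℝ) *
        PowerSeries.coeff (N - n) (mixedRatio e n (defect e t x) t) := by
  -- The expansion is cut off at `n = N`, which makes it a finite sum of series; the discarded terms
  -- are divisible by `X ^ (N + 1)` and do not affect degrees up to `N`.
  have key : ∀ k ≤ N, PowerSeries.coeff k (partitionSeries e (screen e t x)) =
      PowerSeries.coeff k (∑ n ∈ Finset.range (N + 1), PowerSeries.X ^ n *
        (PowerSeries.C (1 / (n.factorial : ℝ)) * mixedSeries e n (defect e t x) t)) := by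
    intro k hk
    rw [coeff_partitionSeries_screen he k ht x, map_sum,
      ← Finset.sum_subset (Finset.range_subset_range.2 (Nat.succ_le_succ hk))]
    · refine Finset.sum_congr rfl fun n hn => ?_
      rw [PowerSeries.coeff_X_pow_mul', if_pos (Finset.mem_range_succ_iff.1 hn),
        PowerSeries.coeff_C_mul]
    · intro n _ hn
      rw [PowerSeries.coeff_X_pow_mul', if_neg (by simpa using hn)]
  rw [ratioSeries, coeff_mul_congr key, Finset.sum_mul, map_sum]
  refine Finset.sum_congr rfl fun n hn => ?_
  rw [mul_assoc, mul_assoc, PowerSeries.coeff_X_pow_mul', if_pos (Finset.mem_range_succ_iff.1 hn),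
    PowerSeries.coeff_C_mul]
  rfl

/-- The coefficients of the solution `M` of `M = ∑ n, g n / n! X ^ n M ^ n`. -/
noncomputable def treeCoeff (g : ℕ → ℝ) (N : ℕ) : ℝ :=
  ∑ n ∈ Finset.range (N + 1), g n / (n.factorial : ℝ) *
    PowerSeries.coeff (N - n)
      ((PowerSeries.mk fun i => if _ : i < N then treeCoeff g i else 0) ^ n)

/-- The formal power series with coefficients `treeCoeff`. -/
noncomputable def treeSeries (g : ℕ → ℝ) : PowerSeries ℝ := PowerSeries.mk (treeCoeff g)

lemma coeff_pow_congr {A B : PowerSeries ℝ} (k : ℕ) {N : ℕ}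
    (h : ∀ n ≤ N, PowerSeries.coeff n A = PowerSeries.coeff n B) :
    PowerSeries.coeff N (A ^ k) = PowerSeries.coeff N (B ^ k) := by
  induction k generalizing N with
  | zero => simp
  | succ k ih =>
    rw [pow_succ, pow_succ, PowerSeries.coeff_mul, PowerSeries.coeff_mul]
    refine Finset.sum_congr rfl fun p hp => ?_
    rw [h _ (Finset.HasAntidiagonal.antidiagonal.snd_le hp),
      ih fun n hn => h n (hn.trans (Finset.HasAntidiagonal.antidiagonal.fst_le hp))]

/-- The cutoff `i < N` in the recursion only ensures termination: for `n = 0` the power is `1`, and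
for `n ≥ 1` the coefficient of degree `N - n` involves only indices below `N`. -/
lemma treeCoeff_eq (g : ℕ → ℝ) (N : ℕ) : treeCoeff g N =
    ∑ n ∈ Finset.range (N + 1), g n / (n.factorial : ℝ) *
      PowerSeries.coeff (N - n) (treeSeries g ^ n) := by
  rw [treeCoeff]
  refine Finset.sum_congr rfl fun n hn => ?_
  have hn' := Finset.mem_range_succ_iff.1 hn
  rcases Nat.eq_zero_or_pos n with rfl | h0
  · simp
  congr 1
  refine coeff_pow_congr n fun k hk => ?_
  have hkN : k < N := by omega
  simp [treeSeries, hkN]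

lemma coeff_mul_nonneg {A B : PowerSeries ℝ} {N : ℕ}
    (hA : ∀ n ≤ N, 0 ≤ PowerSeries.coeff n A) (hB : ∀ n ≤ N, 0 ≤ PowerSeries.coeff n B) :
    0 ≤ PowerSeries.coeff N (A * B) := by
  rw [PowerSeries.coeff_mul]
  exact Finset.sum_nonneg fun p hp => mul_nonneg (hA _ (Finset.HasAntidiagonal.antidiagonal.fst_le hp))
    (hB _ (Finset.HasAntidiagonal.antidiagonal.snd_le hp))

lemma coeff_pow_nonneg {A : PowerSeries ℝ} (k : ℕ) {N : ℕ}
    (hA : ∀ n ≤ N, 0 ≤ PowerSeries.coeff n A) : 0 ≤ PowerSeries.coeff N (A ^ k) := by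
  induction k generalizing N with
  | zero => simp only [pow_zero, PowerSeries.coeff_one]; split_ifs <;> simp
  | succ k ih =>
    rw [pow_succ]
    exact coeff_mul_nonneg (fun n hn => ih fun i hi => hA i (hi.trans hn)) hA

lemma treeCoeff_nonneg {g : ℕ → ℝ} (hg : ∀ n, 0 ≤ g n) (N : ℕ) : 0 ≤ treeCoeff g N := by
  induction N using Nat.strong_induction_on with
  | _ N ih =>
    rw [treeCoeff_eq]
    refine Finset.sum_nonneg fun n hn => mul_nonneg (div_nonneg (hg n) (Nat.cast_nonneg _)) ?_
    rcases Nat.eq_zero_or_pos n with rfl | h0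
    · simp only [pow_zero, PowerSeries.coeff_one]; split_ifs <;> simp
    refine coeff_pow_nonneg n fun k hk => ?_
    have hn' := Finset.mem_range_succ_iff.1 hn
    rw [treeSeries, PowerSeries.coeff_mk]
    exact ih k (by omega)

lemma coeff_treeSeries_pow_nonneg {g : ℕ → ℝ} (hg : ∀ n, 0 ≤ g n) (k N : ℕ) :
    0 ≤ PowerSeries.coeff N (treeSeries g ^ k) :=
  coeff_pow_nonneg k fun n _ => by
    rw [treeSeries, PowerSeries.coeff_mk]; exact treeCoeff_nonneg hg n

/-- Bounds on the coefficients of `ratioSeries` pass on to `mixedRatio`. -/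
lemma coeff_mixedRatio_mem (he : IsPairFactor e) {g : ℕ → ℝ} (hg : ∀ n, 0 ≤ g n) {N : ℕ}
    (hF : ∀ n ≤ N, ∀ t, IsActivity t → ∀ x : Space d,
      PowerSeries.coeff n (ratioSeries e t x) ∈ Set.Icc 0 (treeCoeff g n)) (k : ℕ) :
    ∀ n ≤ N, ∀ b t : Space d → ℝ, IsActivity b → IsActivity t →
      PowerSeries.coeff n (mixedRatio e k b t) ∈
        Set.Icc 0 (PowerSeries.coeff n (treeSeries g ^ k) * configInt e k b) := by
  induction k with
  | zero =>
    intro n _ b t _ _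
    rw [mixedRatio_zero, pow_zero, configInt, mul_one]
    refine ⟨?_, le_rfl⟩
    rw [PowerSeries.coeff_one]; split_ifs <;> simp
  | succ k ih =>
    intro n hn b t hb ht
    obtain ⟨hint, heq⟩ := coeff_mixedRatio_succ_aux he n k hb ht
    have h0 : ∀ y, 0 ≤ PowerSeries.coeff n
        (ratioSeries e t y * mixedRatio e k (screen e b y) (screen e t y)) := fun y =>
      coeff_mul_nonneg (fun i hi => (hF i (hi.trans hn) t ht y).1)
        (fun i hi => (ih i (hi.trans hn) _ _ (hb.screen he y) (ht.screen he y)).1)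
    have h1 : ∀ y, PowerSeries.coeff n
        (ratioSeries e t y * mixedRatio e k (screen e b y) (screen e t y)) ≤
        PowerSeries.coeff n (treeSeries g ^ (k + 1)) * configInt e k (screen e b y) := by
      intro y
      rw [pow_succ', PowerSeries.coeff_mul, PowerSeries.coeff_mul, Finset.sum_mul]
      refine Finset.sum_le_sum fun p hp => ?_
      have h2 := hF p.1 ((Finset.HasAntidiagonal.antidiagonal.fst_le hp).trans hn) t ht y
      have h3 := ih p.2 ((Finset.HasAntidiagonal.antidiagonal.snd_le hp).trans hn) _ _ (hb.screen he y)
        (ht.screen he y)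
      rw [mul_assoc, treeSeries, PowerSeries.coeff_mk]
      exact mul_le_mul h2.2 h3.2 h3.1 (treeCoeff_nonneg hg _)
    rw [heq]
    refine ⟨integral_nonneg fun y => mul_nonneg (hb.nonneg y) (h0 y), ?_⟩
    rw [configInt, ← integral_const_mul]
    refine integral_mono hint ((integrable_mul_configInt he k hb hb).const_mul _) fun y => ?_
    calc _ ≤ b y * (PowerSeries.coeff n (treeSeries g ^ (k + 1)) * configInt e k (screen e b y)) :=
          mul_le_mul_of_nonneg_left (h1 y) (hb.nonneg y)
      _ = _ := by ring

/-- The defect is at most the translate of `1 - e` by `x`, and translation does not change the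
integral; hence a bound by `g(n)` independent of `t` and `x`. -/
lemma configInt_defect_le (he : IsPairFactor e) (hu : IsActivity fun x => 1 - e x) (n : ℕ)
    {t : Space d → ℝ} (ht : IsActivity t) (x : Space d) :
    configInt e n (defect e t x) ≤ configInt e n fun x => 1 - e x := by
  have h := configInt_translate (e := e) n (fun x => 1 - e x) (-x)
  have hx : IsActivity fun w => 1 - e (w + -x) :=
    ⟨hu.measurable.comp (measurable_id.add_const (-x)), fun w => hu.nonneg _, fun w => hu.le_one _,
      hu.integrable.comp_add_right (-x)⟩
  rw [← h]
  refine configInt_mono he n (ht.defect he x) hx fun w => ?_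
  rw [defect, sub_eq_add_neg w x]
  exact mul_le_of_le_one_left (hu.nonneg _) (ht.le_one w)

/-- The coefficients of the ratios are nonnegative and dominated by the tree coefficients. -/
theorem coeff_ratioSeries_mem (he : IsPairFactor e) (hu : IsActivity fun x => 1 - e x) (N : ℕ) :
    ∀ t, IsActivity t → ∀ x : Space d, PowerSeries.coeff N (ratioSeries e t x) ∈
      Set.Icc 0 (treeCoeff (fun n => configInt e n fun x => 1 - e x) N) := by
  have hg : ∀ n, 0 ≤ configInt e n fun x => 1 - e x := fun n => configInt_nonneg he n hu
  induction N using Nat.strong_induction_on with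
  | _ N ih =>
    intro t ht x
    have hn : ∀ n ∈ Finset.range (N + 1), PowerSeries.coeff (N - n)
        (mixedRatio e n (defect e t x) t) ∈ Set.Icc 0 (PowerSeries.coeff (N - n)
          (treeSeries (fun n => configInt e n fun x => 1 - e x) ^ n) *
          configInt e n (defect e t x)) := by
      intro n hn
      -- For `n = 0` the degree `N - n` is not below `N` and the induction hypothesis says nothing,
      -- but there the normalized integral is `1`.
      rcases Nat.eq_zero_or_pos n with rfl | h0
      · rw [mixedRatio_zero, pow_zero, configInt, mul_one]
        refine ⟨?_, le_rfl⟩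
        rw [PowerSeries.coeff_one]; split_ifs <;> simp
      · have hn' := Finset.mem_range_succ_iff.1 hn
        exact coeff_mixedRatio_mem he hg (N := N - n) (fun k hk => ih k (by omega)) n _ le_rfl _ _
          (ht.defect he x) ht
    rw [coeff_ratioSeries he N ht, treeCoeff_eq]
    refine ⟨Finset.sum_nonneg fun n h => mul_nonneg (by positivity) (hn n h).1,
      Finset.sum_le_sum fun n h => ?_⟩
    have h1 := (hn n h).2.trans (mul_le_mul_of_nonneg_left (configInt_defect_le he hu n ht x)
      (coeff_treeSeries_pow_nonneg hg n (N - n)))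
    rw [div_mul_eq_mul_div, div_mul_eq_mul_div, one_mul, mul_comm (configInt e n fun x => 1 - e x)]
    exact div_le_div_of_nonneg_right h1 (Nat.cast_nonneg _)

lemma sum_range_antidiagonal_le {a b : ℕ → ℝ} (ha : ∀ n, 0 ≤ a n) (hb : ∀ n, 0 ≤ b n) (N : ℕ) :
    ∑ n ∈ Finset.range N, ∑ p ∈ Finset.HasAntidiagonal.antidiagonal n, a p.1 * b p.2 ≤
      (∑ n ∈ Finset.range N, a n) * ∑ n ∈ Finset.range N, b n := by
  have h : ∑ n ∈ Finset.range N, ∑ p ∈ Finset.HasAntidiagonal.antidiagonal n, a p.1 * b p.2 =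
      ∑ p ∈ (Finset.range N ×ˢ Finset.range N).filter (fun p => p.1 + p.2 < N), a p.1 * b p.2 := by
    rw [← Finset.sum_fiberwise_of_maps_to (s := (Finset.range N ×ˢ Finset.range N).filter
      (fun p => p.1 + p.2 < N)) (t := Finset.range N) (g := fun p => p.1 + p.2)
      (fun p hp => by simpa using (Finset.mem_filter.1 hp).2)]
    refine Finset.sum_congr rfl fun n hn => Finset.sum_congr ?_ fun _ _ => rfl
    ext p
    simp only [Finset.HasAntidiagonal.mem_antidiagonal, Finset.mem_filter, Finset.mem_product,
      Finset.mem_range] at hn ⊢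
    omega
  rw [h, Finset.sum_mul_sum, ← Finset.sum_product']
  exact Finset.sum_le_sum_of_subset_of_nonneg (Finset.filter_subset _ _)
    fun p _ _ => mul_nonneg (ha _) (hb _)

/-- With nonnegative coefficients, truncating a product keeps only some of the terms in the product
of the truncations. -/
lemma sum_coeff_pow_le {A : PowerSeries ℝ} (hA : ∀ n, 0 ≤ PowerSeries.coeff n A) {r : ℝ}
    (hr : 0 ≤ r) (N : ℕ) {k : ℕ} (hk : k ≠ 0) :
    ∑ n ∈ Finset.range N, PowerSeries.coeff n (A ^ k) * r ^ n ≤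
      (∑ n ∈ Finset.range N, PowerSeries.coeff n A * r ^ n) ^ k := by
  induction k, Nat.one_le_iff_ne_zero.2 hk using Nat.le_induction with
  | base => simp
  | succ k hk ih =>
    have hpos : ∀ n, 0 ≤ PowerSeries.coeff n (A ^ k) :=
      fun n => coeff_pow_nonneg k fun i _ => hA i
    have h := sum_range_antidiagonal_le (a := fun n => PowerSeries.coeff n (A ^ k) * r ^ n)
      (b := fun n => PowerSeries.coeff n A * r ^ n) (fun n => mul_nonneg (hpos n) (pow_nonneg hr n))
      (fun n => mul_nonneg (hA n) (pow_nonneg hr n)) N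
    rw [pow_succ, pow_succ]
    refine le_trans (le_of_eq ?_) (h.trans (mul_le_mul_of_nonneg_right (ih (by omega))
      (Finset.sum_nonneg fun n _ => mul_nonneg (hA n) (pow_nonneg hr n))))
    refine Finset.sum_congr rfl fun n _ => ?_
    rw [PowerSeries.coeff_mul, Finset.sum_mul]
    refine Finset.sum_congr rfl fun p hp => ?_
    rw [← Finset.HasAntidiagonal.mem_antidiagonal.1 hp, pow_add]; ring

/-- If `r Ψ(μ) ≤ μ`, the partial sums of the tree series at `r` are at most `μ / r`. -/
theorem sum_treeCoeff_le {g : ℕ → ℝ} (hg : ∀ n, 0 ≤ g n) {r μ : ℝ} (hr : 0 ≤ r) (hμ : 0 ≤ μ)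
    (h : ∀ N, r * ∑ n ∈ Finset.range N, μ ^ n / (n.factorial : ℝ) * g n ≤ μ) (N : ℕ) :
    ∑ n ∈ Finset.range N, treeCoeff g n * r ^ (n + 1) ≤ μ := by
  have hM : ∀ n, 0 ≤ PowerSeries.coeff n (treeSeries g) := fun n => by
    rw [treeSeries, PowerSeries.coeff_mk]; exact treeCoeff_nonneg hg n
  induction N with
  | zero => simpa using hμ
  | succ N ih =>
    set S := ∑ n ∈ Finset.range N, PowerSeries.coeff n (treeSeries g) * r ^ n with hS
    have hSμ : r * S ≤ μ := by
      refine le_trans (le_of_eq ?_) ih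
      rw [hS, Finset.mul_sum]
      refine Finset.sum_congr rfl fun n _ => ?_
      rw [treeSeries, PowerSeries.coeff_mk, pow_succ]; ring
    have hS0 : 0 ≤ S := Finset.sum_nonneg fun n _ => mul_nonneg (hM n) (pow_nonneg hr n)
    have h1 : ∑ n ∈ Finset.range (N + 1), treeCoeff g n * r ^ n ≤
        ∑ k ∈ Finset.range (N + 1), (r * S) ^ k / (k.factorial : ℝ) * g k := by
      have h2 : ∑ n ∈ Finset.range (N + 1), treeCoeff g n * r ^ n =
          ∑ k ∈ Finset.range (N + 1), g k / (k.factorial : ℝ) * r ^ k *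
            ∑ j ∈ Finset.range (N + 1 - k),
              PowerSeries.coeff j (treeSeries g ^ k) * r ^ j := by
        simp_rw [treeCoeff_eq, Finset.sum_mul, Finset.mul_sum]
        rw [Finset.sum_sigma', Finset.sum_sigma']
        -- The triangle `k ≤ n ≤ N` is reindexed by `k` and `j = n - k`, so that `r ^ k` splits off.
        refine Finset.sum_bij' (fun q _ => ⟨q.2, q.1 - q.2⟩) (fun q _ => ⟨q.1 + q.2, q.1⟩)
          ?_ ?_ ?_ ?_ ?_
        · rintro ⟨n, k⟩ hq
          simp only [Finset.mem_sigma, Finset.mem_range] at hq ⊢; omega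
        · rintro ⟨k, j⟩ hq
          simp only [Finset.mem_sigma, Finset.mem_range] at hq ⊢; omega
        · rintro ⟨n, k⟩ hq
          simp only [Finset.mem_sigma, Finset.mem_range] at hq
          simp only [Sigma.mk.injEq, heq_eq_eq, and_true]; omega
        · rintro ⟨k, j⟩ hq
          simp
        · rintro ⟨n, k⟩ hq
          simp only [Finset.mem_sigma, Finset.mem_range] at hq
          obtain ⟨m, rfl⟩ := Nat.exists_eq_add_of_le (Nat.lt_succ_iff.1 hq.2)
          simp only [Nat.add_sub_cancel_left, pow_add]; ring
      rw [h2]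
      refine Finset.sum_le_sum fun k hk => ?_
      have hk' := Finset.mem_range_succ_iff.1 hk
      -- For `k ≥ 1` the factor `X ^ k` lowers the remaining degree below `N`, so the partial sum
      -- `S` of the induction hypothesis suffices; for `k = 0` both sides are `1`.
      have h3 : ∑ j ∈ Finset.range (N + 1 - k), PowerSeries.coeff j (treeSeries g ^ k) * r ^ j ≤
          S ^ k := by
        rcases Nat.eq_zero_or_pos k with rfl | h0
        · simp [PowerSeries.coeff_one, Finset.sum_ite_eq']
        · refine le_trans (Finset.sum_le_sum_of_subset_of_nonneg
            (Finset.range_subset_range.2 (by omega : N + 1 - k ≤ N)) fun j _ _ =>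
            mul_nonneg (coeff_treeSeries_pow_nonneg hg k j) (pow_nonneg hr j))
            (sum_coeff_pow_le hM hr N h0.ne')
      calc _ ≤ g k / (k.factorial : ℝ) * r ^ k * S ^ k := mul_le_mul_of_nonneg_left h3
            (mul_nonneg (div_nonneg (hg k) (Nat.cast_nonneg _)) (pow_nonneg hr k))
        _ = _ := by rw [mul_pow]; ring
    have h4 : ∑ k ∈ Finset.range (N + 1), (r * S) ^ k / (k.factorial : ℝ) * g k ≤
        ∑ k ∈ Finset.range (N + 1), μ ^ k / (k.factorial : ℝ) * g k := by
      refine Finset.sum_le_sum fun k _ => mul_le_mul_of_nonneg_right ?_ (hg k)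
      exact div_le_div_of_nonneg_right (pow_le_pow_left₀ (mul_nonneg hr hS0) hSμ k)
        (Nat.cast_nonneg _)
    calc _ = r * ∑ n ∈ Finset.range (N + 1), treeCoeff g n * r ^ n := by
          rw [Finset.mul_sum]
          exact Finset.sum_congr rfl fun n _ => by rw [pow_succ]; ring
      _ ≤ _ := (mul_le_mul_of_nonneg_left (h1.trans h4) hr).trans (h (N + 1))

end RepulsiveGas

/-! ### Primitives of power series, their exponentials and Taylor coefficients. -/

namespace RepulsiveGas

/-- The primitive `∑ c_n z^{n+1} / (n+1)` of the power series `∑ c_n z^n`. -/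
noncomputable def primitiveSeries (c : ℕ → ℂ) (z : ℂ) : ℂ :=
  ∑' n : ℕ, c n / ((n : ℂ) + 1) * z ^ (n + 1)

lemma norm_primitive_term_le (c : ℕ → ℂ) {r : ℝ} {z : ℂ} (hz : ‖z‖ ≤ r) (n : ℕ) :
    ‖c n / ((n : ℂ) + 1) * z ^ (n + 1)‖ ≤ ‖c n‖ * r ^ (n + 1) := by
  rw [norm_mul, norm_div, norm_pow]
  have h1 : (1 : ℝ) ≤ ‖(n : ℂ) + 1‖ := by
    rw [← Nat.cast_succ, Complex.norm_natCast]; exact_mod_cast Nat.succ_pos n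
  exact mul_le_mul (div_le_self (norm_nonneg _) h1) (pow_le_pow_left₀ (norm_nonneg _) hz _)
    (pow_nonneg (norm_nonneg _) _) (norm_nonneg _)

lemma summable_mul_pow_succ {c : ℕ → ℂ} {r : ℝ} (hc : Summable fun n => ‖c n‖ * r ^ n) :
    Summable fun n => ‖c n‖ * r ^ (n + 1) := by
  refine (hc.mul_left r).congr fun n => ?_
  rw [pow_succ]; ring

lemma summable_primitive {c : ℕ → ℂ} {r : ℝ} (hc : Summable fun n => ‖c n‖ * r ^ n) {z : ℂ}
    (hz : ‖z‖ ≤ r) : Summable fun n : ℕ => c n / ((n : ℂ) + 1) * z ^ (n + 1) :=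
  Summable.of_norm_bounded (summable_mul_pow_succ hc) (norm_primitive_term_le c hz)

lemma continuousOn_primitiveSeries {c : ℕ → ℂ} {r : ℝ} (hc : Summable fun n => ‖c n‖ * r ^ n) :
    ContinuousOn (primitiveSeries c) (Metric.closedBall 0 r) :=
  continuousOn_tsum (fun n => by fun_prop) (summable_mul_pow_succ hc)
    fun n z hz => norm_primitive_term_le c (by simpa using hz) n

lemma primitiveSeries_zero (c : ℕ → ℂ) : primitiveSeries c 0 = 0 := by
  simp [primitiveSeries]

lemma hasDerivAt_primitiveSeries {c : ℕ → ℂ} {r : ℝ} (hr : 0 < r)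
    (hc : Summable fun n => ‖c n‖ * r ^ n) {z : ℂ} (hz : z ∈ Metric.ball (0 : ℂ) r) :
    HasDerivAt (primitiveSeries c) (∑' n, c n * z ^ n) z := by
  refine hasDerivAt_tsum_of_isPreconnected (g := fun (n : ℕ) z => c n / ((n : ℂ) + 1) * z ^ (n + 1))
    (g' := fun n z => c n * z ^ n) hc Metric.isOpen_ball
    (convex_ball (0 : ℂ) r).isPreconnected ?_ ?_ (Metric.mem_ball_self hr) (by simp) hz
  · intro n y _
    have h := (hasDerivAt_pow (n + 1) y).const_mul (c n / ((n : ℂ) + 1))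
    refine h.congr_deriv ?_
    have : (n : ℂ) + 1 ≠ 0 := Nat.cast_add_one_ne_zero n
    push_cast
    field_simp
  · intro n y hy
    rw [norm_mul, norm_pow]
    exact mul_le_mul_of_nonneg_left (pow_le_pow_left₀ (norm_nonneg _)
      (by simpa using (Metric.mem_ball.1 hy).le) n) (norm_nonneg _)

/-- A power series `1 + ∑ Z_N z^N` that satisfies `Ξ' = Ξ L'` is the exponential of `L`. -/
theorem exp_primitiveSeries {Z c : ℕ → ℂ} {r : ℝ} (hr : 0 < r) (hZ0 : Z 0 = 1)
    (hrec : ∀ N : ℕ, ((N : ℂ) + 1) * Z (N + 1) =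
      ∑ p ∈ Finset.HasAntidiagonal.antidiagonal N, Z p.1 * c p.2)
    (hZ : Summable fun n => ‖Z n‖ * r ^ n) (hc : Summable fun n => ‖c n‖ * r ^ n) {z : ℂ}
    (hz : ‖z‖ ≤ r) :
    Complex.exp (primitiveSeries c z) = 1 + ∑' N : ℕ, Z (N + 1) * z ^ (N + 1) := by
  -- These are the coefficients of `Ξ'`, so that `Ξ = 1 + primitiveSeries a` and the recursion reads
  -- `Ξ L' = Ξ'`.
  set a : ℕ → ℂ := fun N => ((N : ℂ) + 1) * Z (N + 1) with ha
  have hprim : ∀ z, ∑' N : ℕ, Z (N + 1) * z ^ (N + 1) = primitiveSeries a z := by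
    intro z
    refine tsum_congr fun n => ?_
    rw [ha, mul_div_cancel_left₀ _ (Nat.cast_add_one_ne_zero n)]
  have hnorm : ∀ {f : ℕ → ℂ}, (Summable fun n => ‖f n‖ * r ^ n) → ∀ {y : ℂ}, ‖y‖ ≤ r →
      Summable fun n => ‖f n * y ^ n‖ := by
    intro f hf y hy
    refine hf.of_nonneg_of_le (fun _ => norm_nonneg _) fun n => ?_
    rw [norm_mul, norm_pow]
    exact mul_le_mul_of_nonneg_left (pow_le_pow_left₀ (norm_nonneg _) hy n) (norm_nonneg _)
  have hanti : ∀ (y : ℂ) (n : ℕ), ∑ p ∈ Finset.HasAntidiagonal.antidiagonal n,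
      Z p.1 * y ^ p.1 * (c p.2 * y ^ p.2) = a n * y ^ n := by
    intro y n
    change _ = ((n : ℂ) + 1) * Z (n + 1) * y ^ n
    rw [hrec, Finset.sum_mul]
    refine Finset.sum_congr rfl fun p hp => ?_
    rw [← Finset.HasAntidiagonal.mem_antidiagonal.1 hp, pow_add]; ring
  have hrr : ‖(r : ℂ)‖ = r := by simp [abs_of_pos hr]
  -- Summability of `Ξ'` at radius `r` is not assumed: it follows from the Cauchy product of `Z` and
  -- `c` at the real point `r`.
  have hasum : Summable fun n => ‖a n‖ * r ^ n := by
    refine (summable_norm_sum_mul_antidiagonal_of_summable_norm (hnorm hZ hrr.le)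
      (hnorm hc hrr.le)).congr fun n => ?_
    rw [hanti, norm_mul, norm_pow, hrr]
  have hprod : ∀ y : ℂ, ‖y‖ ≤ r →
      (1 + primitiveSeries a y) * (∑' n, c n * y ^ n) = ∑' n, a n * y ^ n := by
    intro y hy
    have hZs := (hnorm hZ hy)
    have h1 : 1 + primitiveSeries a y = ∑' n, Z n * y ^ n := by
      rw [hZs.of_norm.tsum_eq_zero_add, hprim]; simp [hZ0]
    rw [h1, tsum_mul_tsum_eq_tsum_sum_antidiagonal_of_summable_norm hZs (hnorm hc hy)]
    exact tsum_congr fun n => hanti y n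
  rw [hprim]
  -- In the open disc `exp (-L) Ξ` has derivative zero and equals `1` at the origin.
  have hball : Set.EqOn (fun y => Complex.exp (primitiveSeries c y))
      (fun y => 1 + primitiveSeries a y) (Metric.ball 0 r) := by
    intro y hy
    set f : ℂ → ℂ := fun y => Complex.exp (-primitiveSeries c y) * (1 + primitiveSeries a y)
    have hder : ∀ y ∈ Metric.ball (0 : ℂ) r, HasDerivAt f 0 y := by
      intro y hy
      have h := (hasDerivAt_primitiveSeries hr hc hy).fun_neg.cexp.mul
        ((hasDerivAt_primitiveSeries hr hasum hy).const_add 1)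
      refine h.congr_deriv ?_
      rw [← hprod y (by simpa using (Metric.mem_ball.1 hy).le)]
      ring
    have hconst : f y = f 0 := Metric.isOpen_ball.is_const_of_deriv_eq_zero
      (convex_ball (0 : ℂ) r).isPreconnected
      (fun y hy => (hder y hy).differentiableAt.differentiableWithinAt)
      (fun y hy => (hder y hy).deriv) hy (Metric.mem_ball_self hr)
    have h0 : f 0 = 1 := by simp [f, primitiveSeries_zero]
    rw [h0] at hconst
    simp only [f, Complex.exp_neg] at hconst
    have hne := Complex.exp_ne_zero (primitiveSeries c y)
    field_simp at hconst
    exact hconst.symm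
  -- Both sides are continuous up to the boundary, which adds the circle `|z| = r`.
  have hcl := hball.of_subset_closure (t := Metric.closedBall 0 r)
    (Complex.continuous_exp.comp_continuousOn (continuousOn_primitiveSeries hc))
    (continuousOn_const.add (continuousOn_primitiveSeries hasum)) Metric.ball_subset_closedBall
    (closure_ball (0 : ℂ) hr.ne').ge
  exact hcl (by simpa using hz)

/-- The Taylor coefficients at `0` of a function that is a `primitiveSeries` near `0`. -/
theorem iteratedDeriv_primitiveSeries {c : ℕ → ℂ} {r : ℝ} (hr : 0 < r)
    (hc : Summable fun n => ‖c n‖ * r ^ n) (n : ℕ) :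
    iteratedDeriv n (primitiveSeries c) 0 =
      (n.factorial : ℂ) * (if n = 0 then 0 else c (n - 1) / (n : ℂ)) := by
  set q : ℕ → ℂ := fun n => if n = 0 then 0 else c (n - 1) / (n : ℂ) with hq
  set p := FormalMultilinearSeries.ofScalars ℂ q
  have hqs : ∀ n, q (n + 1) = c n / ((n : ℂ) + 1) := fun n => by simp [hq]
  have hsum : Summable fun n => ‖p n‖ * r ^ n := by
    rw [← summable_nat_add_iff 1]
    refine (summable_mul_pow_succ hc).of_nonneg_of_le (fun n => by positivity) fun n => ?_
    rw [FormalMultilinearSeries.ofScalars_norm, hqs]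
    have h := norm_primitive_term_le c (r := r) (z := (r : ℂ)) (by simp [abs_of_pos hr]) n
    rwa [norm_mul, norm_pow, Complex.norm_real, Real.norm_of_nonneg hr.le] at h
  have hrad : (0 : ℝ≥0∞) < p.radius := by
    refine lt_of_lt_of_le ?_ (p.le_radius_of_summable (r := ⟨r, hr.le⟩) hsum)
    exact ENNReal.coe_pos.2 hr
  have hps := p.hasFPowerSeriesOnBall hrad
  have heq : p.sum =ᶠ[𝓝 0] primitiveSeries c := by
    filter_upwards [Metric.closedBall_mem_nhds (0 : ℂ) hr] with z hz
    have hz' : ‖z‖ ≤ r := by simpa using hz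
    have hs : Summable fun n => q n * z ^ n := by
      rw [← summable_nat_add_iff 1]
      exact (summable_primitive hc hz').congr fun n => by rw [hqs]
    have h1 : p.sum z = ∑' n, q n * z ^ n := by
      have := FormalMultilinearSeries.ofScalars_sum_eq (E := ℂ) q z
      simpa [FormalMultilinearSeries.ofScalarsSum, smul_eq_mul] using this
    rw [h1, hs.tsum_eq_zero_add, primitiveSeries]
    simp only [hqs]
    simp [hq]
  have hat : HasFPowerSeriesAt (primitiveSeries c) p 0 := hps.hasFPowerSeriesAt.congr heq
  have h2 := hat.analyticAt.hasFPowerSeriesAt.eq_formalMultilinearSeries hat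
  have h3 := congrFun (FormalMultilinearSeries.ofScalars_series_injective (E := ℂ) ℂ h2) n
  rw [div_eq_iff (by exact_mod_cast Nat.factorial_ne_zero n)] at h3
  rw [h3, mul_comm]

end RepulsiveGas

/-! ### The gas in terms of configuration integrals; the logarithmic derivative of `Ξ`. -/

namespace RepulsiveGas
variable {d : ℕ} {e : Space d → ℝ}

lemma integrable_prod_mul_pairFactor (he : IsPairFactor e) (N : ℕ) {t : Space d → ℝ}
    (ht : IsActivity t) : Integrable fun x : Fin N → Space d =>
      (∏ i, t (x i)) * ∏ i, ∏ j ∈ Finset.Ioi i, e (x i - x j) := by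
  have hm : Measurable fun x : Fin N → Space d =>
      (∏ i, t (x i)) * ∏ i, ∏ j ∈ Finset.Ioi i, e (x i - x j) :=
    (Finset.measurable_prod _ fun i _ => ht.measurable.comp (measurable_pi_apply i)).mul
      (Finset.measurable_prod _ fun i _ => Finset.measurable_prod _ fun j _ =>
        he.measurable.comp ((measurable_pi_apply i).sub (measurable_pi_apply j)))
  refine (Integrable.fintype_prod (f := fun (_ : Fin N) => t) fun _ => ht.integrable).mono'
    hm.aestronglyMeasurable (.of_forall fun x => ?_)
  have h0 : 0 ≤ ∏ i, t (x i) := Finset.prod_nonneg fun i _ => ht.nonneg _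
  have h1 : 0 ≤ ∏ i, ∏ j ∈ Finset.Ioi i, e (x i - x j) :=
    Finset.prod_nonneg fun i _ => Finset.prod_nonneg fun j _ => he.nonneg _
  rw [Real.norm_of_nonneg (mul_nonneg h0 h1)]
  exact mul_le_of_le_one_right h0 (Finset.prod_le_one
    (fun i _ => Finset.prod_nonneg fun j _ => he.nonneg _)
    fun i _ => Finset.prod_le_one (fun j _ => he.nonneg _) fun j _ => he.le_one _)

/-- The iterated configuration integral as an integral over `N`-tuples. -/
theorem integral_pi_eq_configInt (he : IsPairFactor e) (N : ℕ) {t : Space d → ℝ}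
    (ht : IsActivity t) : ∫ x : Fin N → Space d,
      (∏ i, t (x i)) * ∏ i, ∏ j ∈ Finset.Ioi i, e (x i - x j) = configInt e N t := by
  induction N generalizing t with
  | zero => simp [configInt, integral_const, Measure.real, volume_pi]
  | succ N ih =>
    set f := fun x : Fin (N + 1) → Space d =>
      (∏ i, t (x i)) * ∏ i, ∏ j ∈ Finset.Ioi i, e (x i - x j) with hf
    -- Coordinate `0` is split off as the outermost particle `y`; its interactions with the others
    -- turn `t` into `screen e t y`.
    have hmp := (volume_preserving_piFinSuccAbove (fun _ : Fin (N + 1) => Space d) 0).symm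
    have hfe : ∀ p : Space d × (Fin N → Space d),
        f ((MeasurableEquiv.piFinSuccAbove (fun _ : Fin (N + 1) => Space d) 0).symm p) =
        t p.1 * ((∏ i, screen e t p.1 (p.2 i)) *
          ∏ i, ∏ j ∈ Finset.Ioi i, e (p.2 i - p.2 j)) := by
      rintro ⟨y, x⟩
      have h : (MeasurableEquiv.piFinSuccAbove (fun _ : Fin (N + 1) => Space d) 0).symm (y, x) =
          Fin.cons y x := by
        funext i
        refine Fin.cases ?_ (fun j => ?_) i <;> simp [MeasurableEquiv.piFinSuccAbove]
      have hev : ∀ i, e (y - x i) = e (x i - y) := fun i => by rw [← he.even, neg_sub]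
      rw [h, hf]
      simp only [Fin.prod_univ_succ, Fin.cons_zero, Fin.cons_succ, Fin.prod_Ioi_zero,
        Fin.prod_Ioi_succ, screen, Finset.prod_mul_distrib, hev]
      ring
    have hint : Integrable (fun p : Space d × (Fin N → Space d) =>
        t p.1 * ((∏ i, screen e t p.1 (p.2 i)) *
          ∏ i, ∏ j ∈ Finset.Ioi i, e (p.2 i - p.2 j))) (volume.prod volume) := by
      have h := (hmp.integrable_comp_emb (MeasurableEquiv.measurableEmbedding _)).2
        (integrable_prod_mul_pairFactor he (N + 1) ht)
      exact h.congr (.of_forall hfe)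
    rw [← hmp.integral_comp' f]
    simp_rw [hfe]
    rw [Measure.volume_eq_prod, integral_prod _ hint, configInt]
    congr 1; funext y
    rw [← ih (ht.screen he y), ← integral_const_mul]

lemma boltzmann_nonneg (β : ℝ) (u : ℝ≥0∞) : 0 ≤ boltzmann β u := by
  unfold boltzmann; split_ifs
  · exact le_rfl
  · exact (Real.exp_pos _).le

lemma boltzmann_le_one {β : ℝ} (hβ : 0 < β) (u : ℝ≥0∞) : boltzmann β u ≤ 1 := by
  unfold boltzmann; split_ifs
  · exact zero_le_one
  · rw [Real.exp_le_one_iff]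
    nlinarith [mul_nonneg hβ.le (ENNReal.toReal_nonneg (a := u))]

lemma measurable_boltzmann (β : ℝ) : Measurable (boltzmann β) :=
  Measurable.ite (measurableSet_singleton _) measurable_const (by fun_prop)

lemma boltzmann_zero (β : ℝ) : boltzmann β 0 = 1 := by simp [boltzmann]

lemma boltzmann_add (β : ℝ) (u v : ℝ≥0∞) :
    boltzmann β (u + v) = boltzmann β u * boltzmann β v := by
  unfold boltzmann
  by_cases hu : u = ⊤
  · simp [hu]
  by_cases hv : v = ⊤
  · simp [hv]
  rw [if_neg hu, if_neg hv, if_neg (ENNReal.add_ne_top.2 ⟨hu, hv⟩), ENNReal.toReal_add hu hv,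
    mul_add, Real.exp_add]

lemma boltzmann_sum {ι : Type*} (β : ℝ) (s : Finset ι) (u : ι → ℝ≥0∞) :
    boltzmann β (∑ i ∈ s, u i) = ∏ i ∈ s, boltzmann β (u i) := by
  classical
  induction s using Finset.induction_on with
  | empty => simp [boltzmann_zero]
  | insert i s hi ih => rw [Finset.sum_insert hi, Finset.prod_insert hi, boltzmann_add, ih]

/-- The pair factor `x ↦ e^{-β φ(|x|)}`. -/
noncomputable def pairFactor (d : ℕ) (β : ℝ) (φ : ℝ → ℝ≥0∞) (x : Space d) : ℝ :=
  boltzmann β (φ ‖x‖)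

variable {β : ℝ} {φ : ℝ → ℝ≥0∞}

lemma isPairFactor_pairFactor (hβ : 0 < β) (hφ : Measurable φ) :
    IsPairFactor (pairFactor d β φ) :=
  ⟨(measurable_boltzmann β).comp (hφ.comp measurable_norm), fun _ => boltzmann_nonneg _ _,
    fun _ => boltzmann_le_one hβ _, fun x => by rw [pairFactor, norm_neg, pairFactor]⟩

lemma isActivity_one_sub_pairFactor (hβ : 0 < β) (hφ : Measurable φ)
    (hC : temperConst d β φ ≠ ⊤) : IsActivity fun x => 1 - pairFactor d β φ x := by
  have he := isPairFactor_pairFactor (d := d) hβ hφ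
  refine ⟨measurable_const.sub he.measurable, fun x => sub_nonneg.2 (he.le_one x),
    fun x => sub_le_self _ (he.nonneg x),
    (measurable_const.sub he.measurable).aestronglyMeasurable, ?_⟩
  rw [hasFiniteIntegral_iff_norm]
  refine lt_of_eq_of_lt ?_ hC.lt_top
  refine lintegral_congr fun x => ?_
  rw [Real.norm_eq_abs, abs_sub_comm]; rfl

lemma isActivity_indicator {Λ : Set (Space d)} (hΛ : IsRegion Λ) :
    IsActivity (Λ.indicator fun _ => (1 : ℝ)) := by
  refine ⟨measurable_const.indicator hΛ.measurableSet,
    Set.indicator_nonneg fun _ _ => zero_le_one, fun x => ?_, ?_⟩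
  · exact Set.indicator_le_self' (fun _ _ => zero_le_one) x
  · exact (integrable_indicator_iff hΛ.measurableSet).2
      (integrableOn_const hΛ.volume_ne_top)

lemma integral_boltzmann_energy (hβ : 0 < β) (hφ : Measurable φ) {Λ : Set (Space d)}
    (hΛ : IsRegion Λ) (N : ℕ) :
    ∫ x in Set.univ.pi (fun _ : Fin N => Λ), boltzmann β (energy φ x) =
      configInt (pairFactor d β φ) N (Λ.indicator fun _ => 1) := by
  rw [← integral_pi_eq_configInt (isPairFactor_pairFactor hβ hφ) N (isActivity_indicator hΛ),
    ← integral_indicator (MeasurableSet.univ_pi fun _ => hΛ.measurableSet)]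
  congr 1; funext x
  by_cases hx : ∀ i, x i ∈ Λ
  · rw [Set.indicator_of_mem (by simpa using hx), Finset.prod_eq_one fun i _ =>
      Set.indicator_of_mem (hx i) _, one_mul, energy, boltzmann_sum]
    refine Finset.prod_congr rfl fun i _ => ?_
    rw [boltzmann_sum]; rfl
  · rw [Set.indicator_of_notMem (by simpa using hx)]
    push Not at hx
    obtain ⟨i, hi⟩ := hx
    rw [Finset.prod_eq_zero (Finset.mem_univ i) (Set.indicator_of_notMem hi _), zero_mul]

lemma vertexIntegral_eq (hβ : 0 < β) (hφ : Measurable φ) (hC : temperConst d β φ ≠ ⊤) (n : ℕ) :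
    vertexIntegral d β φ n =
      configInt (pairFactor d β φ) n fun x => 1 - pairFactor d β φ x :=
  integral_pi_eq_configInt (isPairFactor_pairFactor hβ hφ) n
    (isActivity_one_sub_pairFactor hβ hφ hC)

lemma partitionFun_eq (hβ : 0 < β) (hφ : Measurable φ) {Λ : Set (Space d)} (hΛ : IsRegion Λ)
    (z : ℂ) : partitionFun β φ Λ z = 1 + ∑' N : ℕ,
      (((N + 1).factorial : ℂ)⁻¹ * (configInt (pairFactor d β φ) (N + 1)
        (Λ.indicator fun _ => 1) : ℝ)) * z ^ (N + 1) := by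
  rw [partitionFun]
  congr 1
  refine tsum_congr fun N => ?_
  rw [integral_boltzmann_energy hβ hφ hΛ]
  ring

/-- The coefficients of the logarithmic derivative of the partition function, up to sign. -/
noncomputable def logDerivCoeff (e t : Space d → ℝ) (n : ℕ) : ℝ :=
  ∫ x, t x * PowerSeries.coeff n (ratioSeries e t x)

lemma integrable_mul_coeff_ratioSeries (he : IsPairFactor e) {t : Space d → ℝ}
    (ht : IsActivity t) (n : ℕ) :
    Integrable fun x => t x * PowerSeries.coeff n (ratioSeries e t x) := by
  have h := (coeff_mixedRatio_succ_aux he n 0 ht ht).1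
  simpa only [mixedRatio_zero, mul_one] using h

/-- The relation `Ξ' = Ξ (ln Ξ)'` between coefficients: differentiating in the activity singles out
one particle at `x`, and the partition function seen by the rest is the ratio at `x` times `Ξ`. The
factor `(-1) ^ p.2` converts from activity `-X` to `z`. -/
lemma configInt_succ_eq (he : IsPairFactor e) {t : Space d → ℝ} (ht : IsActivity t) (N : ℕ) :
    ((N : ℝ) + 1) * (((N + 1).factorial : ℝ)⁻¹ * configInt e (N + 1) t) =
      ∑ p ∈ Finset.HasAntidiagonal.antidiagonal N,
        ((p.1.factorial : ℝ)⁻¹ * configInt e p.1 t) * ((-1) ^ p.2 * logDerivCoeff e t p.2) := by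
  have h1 : ∀ x, t x * configInt e N (screen e t x) =
      ∑ p ∈ Finset.HasAntidiagonal.antidiagonal N, ((-1) ^ p.2 * (N.factorial : ℝ) *
        ((p.1.factorial : ℝ)⁻¹ * configInt e p.1 t)) *
          (t x * PowerSeries.coeff p.2 (ratioSeries e t x)) := by
    intro x
    have h := congrArg (PowerSeries.coeff N) (ratioSeries_mul (e := e) t x)
    rw [mul_comm, PowerSeries.coeff_mul, partitionSeries, partitionSeries, PowerSeries.coeff_mk] at h
    have h2 : configInt e N (screen e t x) = (-1) ^ N * (N.factorial : ℝ) *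
        ((-1) ^ N / (N.factorial : ℝ) * configInt e N (screen e t x)) := by
      have h4 : ((-1 : ℝ) ^ N) * (-1) ^ N = 1 := by rw [← mul_pow]; simp
      have := Nat.factorial_ne_zero N
      field_simp
      linear_combination (-configInt e N (screen e t x)) * h4
    rw [h2, ← h, Finset.mul_sum, Finset.mul_sum]
    refine Finset.sum_congr rfl fun p hp => ?_
    have h5 : ((-1 : ℝ) ^ p.1) * (-1) ^ p.1 = 1 := by rw [← mul_pow]; simp
    rw [PowerSeries.coeff_mk, ← Finset.HasAntidiagonal.mem_antidiagonal.1 hp, pow_add]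
    linear_combination ((-1) ^ p.2 * ((p.1 + p.2).factorial : ℝ) * (p.1.factorial : ℝ)⁻¹ *
      configInt e p.1 t * t x * PowerSeries.coeff p.2 (ratioSeries e t x)) * h5
  have h3 : configInt e (N + 1) t = ∑ p ∈ Finset.HasAntidiagonal.antidiagonal N,
      ((-1) ^ p.2 * (N.factorial : ℝ) * ((p.1.factorial : ℝ)⁻¹ * configInt e p.1 t)) *
        logDerivCoeff e t p.2 := by
    rw [configInt]
    simp_rw [h1]
    rw [integral_finsetSum _ fun p _ => (integrable_mul_coeff_ratioSeries he ht p.2).const_mul _]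
    refine Finset.sum_congr rfl fun p _ => ?_
    rw [integral_const_mul, logDerivCoeff]
  rw [h3, Nat.factorial_succ, Finset.mul_sum, Finset.mul_sum]
  refine Finset.sum_congr rfl fun p _ => ?_
  have := Nat.factorial_ne_zero N
  have h6 : (N : ℝ) + 1 ≠ 0 := Nat.cast_add_one_ne_zero N
  push_cast
  field_simp

lemma logDerivCoeff_mem (he : IsPairFactor e) (hu : IsActivity fun x => 1 - e x)
    {t : Space d → ℝ} (ht : IsActivity t) (n : ℕ) : logDerivCoeff e t n ∈
      Set.Icc 0 ((∫ x, t x) * treeCoeff (fun n => configInt e n fun x => 1 - e x) n) := by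
  refine ⟨integral_nonneg fun x => mul_nonneg (ht.nonneg x) (coeff_ratioSeries_mem he hu n t ht x).1,
    ?_⟩
  rw [logDerivCoeff, ← integral_mul_const]
  exact integral_mono (integrable_mul_coeff_ratioSeries he ht n) (ht.integrable.mul_const _)
    fun x => mul_le_mul_of_nonneg_left (coeff_ratioSeries_mem he hu n t ht x).2 (ht.nonneg x)

end RepulsiveGas

/-! ### The finite-volume pressure and its cluster expansion. -/

namespace RepulsiveGas
variable {d : ℕ} {β : ℝ} {φ : ℝ → ℝ≥0∞}

/-- The factors `1 / (n + 1)` from integration are simply estimated by `1`. -/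
lemma norm_primitiveSeries_le {c : ℕ → ℂ} {m : ℕ → ℝ} (hc : ∀ n, ‖c n‖ ≤ m n) {μ : ℝ} {z : ℂ}
    (h : ∀ N, ∑ n ∈ Finset.range N, m n * ‖z‖ ^ (n + 1) ≤ μ) : ‖primitiveSeries c z‖ ≤ μ := by
  have hm : ∀ n, 0 ≤ m n := fun n => (norm_nonneg _).trans (hc n)
  have hpos : ∀ n, 0 ≤ m n * ‖z‖ ^ (n + 1) := fun n => mul_nonneg (hm n) (by positivity)
  have hs : Summable fun n => m n * ‖z‖ ^ (n + 1) := summable_of_sum_range_le hpos h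
  refine (tsum_of_norm_bounded hs.hasSum fun n => ?_).trans (hs.tsum_le_of_sum_range_le h)
  exact (norm_primitive_term_le c le_rfl n).trans
    (mul_le_mul_of_nonneg_right (hc n) (by positivity))

lemma summable_of_sum_mul_pow_succ_le {m : ℕ → ℝ} (hm : ∀ n, 0 ≤ m n) {r μ : ℝ} (hr : 0 < r)
    (h : ∀ N, ∑ n ∈ Finset.range N, m n * r ^ (n + 1) ≤ μ) : Summable fun n => m n * r ^ n := by
  have hs : Summable fun n => m n * r ^ (n + 1) :=
    summable_of_sum_range_le (fun n => mul_nonneg (hm n) (by positivity)) h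
  refine (hs.mul_left r⁻¹).congr fun n => ?_
  rw [pow_succ]; field_simp

/-- The dominating tree coefficients of the gas. -/
noncomputable def gasTreeCoeff (d : ℕ) (β : ℝ) (φ : ℝ → ℝ≥0∞) : ℕ → ℝ :=
  treeCoeff fun n => configInt (pairFactor d β φ) n fun x => 1 - pairFactor d β φ x

/-- The Taylor coefficients of the derivative of the finite-volume pressure. -/
noncomputable def pressureDerivCoeff (β : ℝ) (φ : ℝ → ℝ≥0∞) (Λ : Set (Space d)) (n : ℕ) : ℂ :=
  (((-1) ^ n * ((volume.real Λ)⁻¹ *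
    logDerivCoeff (pairFactor d β φ) (Λ.indicator fun _ => 1) n) : ℝ) : ℂ)

/-- The pressure as the sum of the cluster expansion. -/
noncomputable def pressure (β : ℝ) (φ : ℝ → ℝ≥0∞) (Λ : Set (Space d)) : ℂ → ℂ :=
  primitiveSeries (pressureDerivCoeff β φ Λ)

lemma IsRegion.volume_real_pos {Λ : Set (Space d)} (hΛ : IsRegion Λ) : 0 < volume.real Λ :=
  ENNReal.toReal_pos hΛ.volume_ne_zero hΛ.volume_ne_top

lemma integral_indicator_region {Λ : Set (Space d)} (hΛ : IsRegion Λ) :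
    ∫ x, Λ.indicator (fun _ => (1 : ℝ)) x = volume.real Λ := by
  rw [integral_indicator hΛ.measurableSet]; simp

/-- The integral of the indicator of `Λ` cancels the prefactor `1 / |Λ|`, so the bound does not
depend on the volume. -/
lemma norm_pressureDerivCoeff_le (hβ : 0 < β) (hφ : Measurable φ) (hC : temperConst d β φ ≠ ⊤)
    {Λ : Set (Space d)} (hΛ : IsRegion Λ) (n : ℕ) :
    ‖pressureDerivCoeff β φ Λ n‖ ≤ gasTreeCoeff d β φ n := by
  have h := logDerivCoeff_mem (isPairFactor_pairFactor (d := d) hβ hφ)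
    (isActivity_one_sub_pairFactor hβ hφ hC) (isActivity_indicator hΛ) n
  rw [integral_indicator_region hΛ] at h
  have hv := hΛ.volume_real_pos
  rw [pressureDerivCoeff, Complex.norm_real, Real.norm_eq_abs, abs_mul, abs_pow, abs_neg, abs_one,
    one_pow, one_mul, abs_of_nonneg (mul_nonneg (inv_nonneg.2 hv.le) h.1), inv_mul_le_iff₀ hv]
  exact h.2

lemma gasTreeCoeff_nonneg (hβ : 0 < β) (hφ : Measurable φ) (hC : temperConst d β φ ≠ ⊤) (n : ℕ) :
    0 ≤ gasTreeCoeff d β φ n :=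
  treeCoeff_nonneg (fun n => configInt_nonneg (isPairFactor_pairFactor hβ hφ) n
    (isActivity_one_sub_pairFactor hβ hφ hC)) n

lemma summable_pressureDerivCoeff (hβ : 0 < β) (hφ : Measurable φ) (hC : temperConst d β φ ≠ ⊤)
    {Λ : Set (Space d)} (hΛ : IsRegion Λ) {r : ℝ} (hr : 0 < r)
    (h : Summable fun n => gasTreeCoeff d β φ n * r ^ n) :
    Summable fun n => ‖pressureDerivCoeff β φ Λ n‖ * r ^ n :=
  h.of_nonneg_of_le (fun n => by positivity) fun n =>
    mul_le_mul_of_nonneg_right (norm_pressureDerivCoeff_le hβ hφ hC hΛ n) (by positivity)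

/-- The sum of the cluster expansion is the finite-volume pressure. -/
theorem isFinitePressure_pressure (hβ : 0 < β) (hφ : Measurable φ) (hC : temperConst d β φ ≠ ⊤)
    {Λ : Set (Space d)} (hΛ : IsRegion Λ) {r : ℝ} (hr : 0 < r)
    (h : Summable fun n => gasTreeCoeff d β φ n * r ^ n) :
    IsFinitePressure β φ Λ r (pressure β φ Λ) := by
  have he := isPairFactor_pairFactor (d := d) hβ hφ
  have ht := isActivity_indicator hΛ
  have hs := summable_pressureDerivCoeff hβ hφ hC hΛ hr h
  have hv := hΛ.volume_real_pos
  refine ⟨continuousOn_primitiveSeries hs, primitiveSeries_zero _, fun z hz => ?_⟩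
  set c : ℕ → ℂ := fun n => (volume.real Λ : ℂ) * pressureDerivCoeff β φ Λ n with hc
  have hvP : (volume.real Λ : ℂ) * pressure β φ Λ z = primitiveSeries c z := by
    rw [pressure, primitiveSeries, ← tsum_mul_left]
    exact tsum_congr fun n => by rw [hc]; ring
  have hc' : ∀ n, c n = (((-1) ^ n *
      logDerivCoeff (pairFactor d β φ) (Λ.indicator fun _ => 1) n : ℝ) : ℂ) := by
    intro n
    simp only [hc, pressureDerivCoeff]
    rw [← Complex.ofReal_mul]
    congr 1
    field_simp
  set Z : ℕ → ℂ := fun N => (((N.factorial : ℝ)⁻¹ *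
    configInt (pairFactor d β φ) N (Λ.indicator fun _ => 1) : ℝ) : ℂ) with hZ
  rw [hvP, partitionFun_eq hβ hφ hΛ, exp_primitiveSeries (Z := Z) hr (by simp [hZ, configInt])
    ?_ ?_ ?_ (by simpa using hz)]
  · simp [hZ]
  · intro N
    have h1 := configInt_succ_eq he ht N
    simp only [hc', hZ]
    exact_mod_cast h1
  · have h2 := Real.summable_pow_div_factorial (volume.real Λ * r)
    refine h2.of_nonneg_of_le (fun n => by positivity) fun n => ?_
    have h3 := configInt_le he n ht
    have h4 := configInt_nonneg he n ht
    rw [integral_indicator_region hΛ] at h3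
    simp only [hZ]
    rw [Complex.norm_real, Real.norm_of_nonneg (mul_nonneg (by positivity) h4), mul_pow]
    calc _ ≤ (n.factorial : ℝ)⁻¹ * volume.real Λ ^ n * r ^ n := by gcongr
      _ = _ := by ring
  · refine (hs.mul_left (volume.real Λ)).congr fun n => ?_
    rw [hc]; simp only [norm_mul, Complex.norm_real, Real.norm_of_nonneg hv.le]; ring

/-- Near `0` the imaginary part of `|Λ| P` lies in `(-π, π)`, so the principal logarithm of `Ξ_Λ`
equals `|Λ| P` and the Taylor coefficients of the primitive can be read off. -/
theorem clusterCoeff_eq (hβ : 0 < β) (hφ : Measurable φ) (hC : temperConst d β φ ≠ ⊤)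
    {Λ : Set (Space d)} (hΛ : IsRegion Λ) {r : ℝ} (hr : 0 < r)
    (h : Summable fun n => gasTreeCoeff d β φ n * r ^ n) (n : ℕ) :
    clusterCoeff β φ Λ n =
      (n.factorial : ℂ) * (if n = 0 then 0 else pressureDerivCoeff β φ Λ (n - 1) / (n : ℂ)) := by
  have hP := isFinitePressure_pressure hβ hφ hC hΛ hr h
  have hs := summable_pressureDerivCoeff hβ hφ hC hΛ hr h
  have hv : (volume.real Λ : ℂ) ≠ 0 := by exact_mod_cast hΛ.volume_real_pos.ne'
  rw [← iteratedDeriv_primitiveSeries hr hs n, clusterCoeff]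
  refine Filter.EventuallyEq.iteratedDeriv_eq n ?_
  have hcont : Tendsto (fun z => ((volume.real Λ : ℂ) * pressure β φ Λ z).im) (𝓝 0) (𝓝 0) := by
    have h1 : ContinuousAt (pressure β φ Λ) 0 :=
      hP.continuousOn.continuousAt (Metric.closedBall_mem_nhds _ hr)
    have h2 : ContinuousAt (fun z => ((volume.real Λ : ℂ) * pressure β φ Λ z).im) 0 :=
      Complex.continuous_im.continuousAt.comp (continuousAt_const.mul h1)
    simpa [ContinuousAt, hP.map_zero] using h2
  filter_upwards [Metric.closedBall_mem_nhds (0 : ℂ) hr,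
    hcont.eventually (Ioo_mem_nhds (neg_lt_zero.2 Real.pi_pos) Real.pi_pos)] with z hz him
  rw [← hP.exp_eq z hz, Complex.log_exp him.1 him.2.le, inv_mul_cancel_left₀ hv]
  rfl

lemma clusterCoeff_succ_div (hβ : 0 < β) (hφ : Measurable φ) (hC : temperConst d β φ ≠ ⊤)
    {Λ : Set (Space d)} (hΛ : IsRegion Λ) {r : ℝ} (hr : 0 < r)
    (h : Summable fun n => gasTreeCoeff d β φ n * r ^ n) (n : ℕ) :
    clusterCoeff β φ Λ (n + 1) / ((n + 1).factorial : ℂ) =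
      pressureDerivCoeff β φ Λ n / ((n : ℂ) + 1) := by
  have hf : ((n + 1).factorial : ℂ) ≠ 0 := by exact_mod_cast Nat.factorial_ne_zero _
  rw [clusterCoeff_eq hβ hφ hC hΛ hr h, mul_div_cancel_left₀ _ hf]
  simp

lemma le_expansionRadius {b c : ℕ → ℂ} {r : ℝ} (hr : 0 < r)
    (hc : Summable fun n => ‖c n‖ * r ^ n)
    (hb : ∀ n : ℕ, b (n + 1) / ((n + 1).factorial : ℂ) = c n / ((n : ℂ) + 1)) :
    ENNReal.ofReal r ≤ expansionRadius b := by
  refine FormalMultilinearSeries.le_radius_of_summable _ ?_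
  rw [← summable_nat_add_iff 1]
  refine (summable_mul_pow_succ hc).of_nonneg_of_le (fun n => by positivity) fun n => ?_
  rw [FormalMultilinearSeries.ofScalars_norm, hb, Real.coe_toNNReal _ hr.le]
  have h := norm_primitive_term_le c (r := r) (z := (r : ℂ)) (by simp [abs_of_pos hr]) n
  rwa [norm_mul, norm_pow, Complex.norm_real, Real.norm_of_nonneg hr.le] at h

end RepulsiveGas

/-! ### The infinite-volume limit along van Hove sequences. -/

namespace RepulsiveGas
variable {d : ℕ} {e : Space d → ℝ}

lemma tendsto_screen {t : ℕ → Space d → ℝ} (ht : ∀ x, ∃ l, Tendsto (fun k => t k x) atTop (𝓝 l))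
    (y x : Space d) : ∃ l, Tendsto (fun k => screen e (t k) y x) atTop (𝓝 l) := by
  obtain ⟨l, hl⟩ := ht x
  exact ⟨_, hl.mul_const _⟩

/-- Dominated convergence in the recursion for `mixedRatio`, with `B` as common majorant of the `b
k`. Only the existence of limits is claimed, so they never have to be identified. -/
lemma tendsto_coeff_mixedRatio (he : IsPairFactor e) (hu : IsActivity fun x => 1 - e x) {N : ℕ}
    (hF : ∀ n ≤ N, ∀ t : ℕ → Space d → ℝ, (∀ k, IsActivity (t k)) →
      (∀ x, ∃ l, Tendsto (fun k => t k x) atTop (𝓝 l)) → ∀ x, ∃ l,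
      Tendsto (fun k => PowerSeries.coeff n (ratioSeries e (t k) x)) atTop (𝓝 l))
    {B : Space d → ℝ} (hB : Integrable B) (j : ℕ) :
    ∀ n ≤ N, ∀ b t : ℕ → Space d → ℝ, (∀ k, IsActivity (b k)) → (∀ k, IsActivity (t k)) →
      (∀ k x, b k x ≤ B x) → (∀ x, ∃ l, Tendsto (fun k => b k x) atTop (𝓝 l)) →
      (∀ x, ∃ l, Tendsto (fun k => t k x) atTop (𝓝 l)) →
      ∃ l, Tendsto (fun k => PowerSeries.coeff n (mixedRatio e j (b k) (t k))) atTop (𝓝 l) := by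
  induction j with
  | zero =>
    intro n _ b t _ _ _ _ _
    simp only [mixedRatio_zero]
    exact ⟨_, tendsto_const_nhds⟩
  | succ j ih =>
    intro n hn b t hb ht hbB hbl htl
    set g : ℕ → ℝ := fun n => configInt e n fun x => 1 - e x with hg
    have hg0 : ∀ n, 0 ≤ g n := fun n => configInt_nonneg he n hu
    set h : ℕ → Space d → ℝ := fun k y => b k y * PowerSeries.coeff n
      (ratioSeries e (t k) y * mixedRatio e j (screen e (b k) y) (screen e (t k) y)) with hh
    have hpt : ∀ y, ∃ l, Tendsto (fun k => h k y) atTop (𝓝 l) := by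
      intro y
      obtain ⟨lb, hlb⟩ := hbl y
      -- Membership is placed under the existential so that `choose` yields a limit for every pair,
      -- with a dummy value off the antidiagonal.
      have hp : ∀ p : ℕ × ℕ, ∃ l, p ∈ Finset.HasAntidiagonal.antidiagonal n →
          Tendsto (fun k => PowerSeries.coeff p.1 (ratioSeries e (t k) y) *
            PowerSeries.coeff p.2 (mixedRatio e j (screen e (b k) y) (screen e (t k) y)))
            atTop (𝓝 l) := by
        intro p
        by_cases hp : p ∈ Finset.HasAntidiagonal.antidiagonal n
        · obtain ⟨l1, h1⟩ := hF p.1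
            ((Finset.HasAntidiagonal.antidiagonal.fst_le hp).trans hn) t ht htl y
          obtain ⟨l2, h2⟩ := ih p.2 ((Finset.HasAntidiagonal.antidiagonal.snd_le hp).trans hn)
            (fun k => screen e (b k) y) (fun k => screen e (t k) y)
            (fun k => (hb k).screen he y) (fun k => (ht k).screen he y)
            (fun k x => (mul_le_of_le_one_right ((hb k).nonneg x) (he.le_one _)).trans (hbB k x))
            (tendsto_screen hbl y) (tendsto_screen htl y)
          exact ⟨_, fun _ => h1.mul h2⟩
        · exact ⟨0, fun h => absurd h hp⟩
      choose l hl using hp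
      refine ⟨lb * ∑ p ∈ Finset.HasAntidiagonal.antidiagonal n, l p, ?_⟩
      simp only [hh, PowerSeries.coeff_mul]
      exact hlb.mul (tendsto_finsetSum _ fun p hp => hl p hp)
    choose L hL using hpt
    have hbound : ∀ k y, ‖h k y‖ ≤
        B y * (PowerSeries.coeff n (treeSeries g ^ (j + 1)) * (∫ w, B w) ^ j) := by
      intro k y
      have hr : ∀ i ≤ n, ∀ t, IsActivity t → ∀ x : Space d,
          PowerSeries.coeff i (ratioSeries e t x) ∈ Set.Icc 0 (treeCoeff g i) :=
        fun i _ => coeff_ratioSeries_mem he hu i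
      have h0 : 0 ≤ PowerSeries.coeff n
          (ratioSeries e (t k) y * mixedRatio e j (screen e (b k) y) (screen e (t k) y)) :=
        coeff_mul_nonneg (fun i hi => (hr i hi _ (ht k) y).1)
          fun i hi => (coeff_mixedRatio_mem he hg0 hr j i hi _ _ ((hb k).screen he y)
            ((ht k).screen he y)).1
      have h1 : PowerSeries.coeff n
          (ratioSeries e (t k) y * mixedRatio e j (screen e (b k) y) (screen e (t k) y)) ≤
          PowerSeries.coeff n (treeSeries g ^ (j + 1)) * configInt e j (screen e (b k) y) := by
        rw [pow_succ', PowerSeries.coeff_mul, PowerSeries.coeff_mul, Finset.sum_mul]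
        refine Finset.sum_le_sum fun p hp => ?_
        have h2 := hr p.1 (Finset.HasAntidiagonal.antidiagonal.fst_le hp) _ (ht k) y
        have h3 := coeff_mixedRatio_mem he hg0 hr j p.2
          (Finset.HasAntidiagonal.antidiagonal.snd_le hp) _ _ ((hb k).screen he y)
          ((ht k).screen he y)
        rw [mul_assoc, treeSeries, PowerSeries.coeff_mk]
        exact mul_le_mul h2.2 h3.2 h3.1 (treeCoeff_nonneg hg0 _)
      have h4 : configInt e j (screen e (b k) y) ≤ (∫ w, B w) ^ j :=
        (configInt_le he j ((hb k).screen he y)).trans (pow_le_pow_left₀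
          (integral_nonneg_activity ((hb k).screen he y))
          ((integral_screen_le (hb k) he y).trans
            (integral_mono (hb k).integrable hB (hbB k))) j)
      rw [hh, Real.norm_of_nonneg (mul_nonneg ((hb k).nonneg y) h0)]
      exact mul_le_mul (hbB k y) (h1.trans (mul_le_mul_of_nonneg_left h4
        (coeff_treeSeries_pow_nonneg hg0 _ _))) h0 (((hb k).nonneg y).trans (hbB k y))
    refine ⟨∫ y, L y, ?_⟩
    simp_rw [coeff_mixedRatio_succ he n j (hb _) (ht _)]
    exact tendsto_integral_of_dominated_convergence _
      (fun k => (coeff_mixedRatio_succ_aux he n j (hb k) (ht k)).1.aestronglyMeasurable)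
      (hB.mul_const _) (fun k => .of_forall (hbound k)) (.of_forall hL)

/-- The coefficients of the ratios depend continuously on the activity. -/
theorem tendsto_coeff_ratioSeries (he : IsPairFactor e) (hu : IsActivity fun x => 1 - e x) (N : ℕ) :
    ∀ t : ℕ → Space d → ℝ, (∀ k, IsActivity (t k)) →
      (∀ x, ∃ l, Tendsto (fun k => t k x) atTop (𝓝 l)) → ∀ x, ∃ l,
      Tendsto (fun k => PowerSeries.coeff N (ratioSeries e (t k) x)) atTop (𝓝 l) := by
  induction N using Nat.strong_induction_on with
  | _ N ih =>
    intro t ht htl x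
    have hp : ∀ n, ∃ l, n ∈ Finset.range (N + 1) → Tendsto (fun k => 1 / (n.factorial : ℝ) *
        PowerSeries.coeff (N - n) (mixedRatio e n (defect e (t k) x) (t k))) atTop (𝓝 l) := by
      intro n
      rcases Nat.eq_zero_or_pos n with rfl | h0
      · simp only [mixedRatio_zero]
        exact ⟨_, fun _ => tendsto_const_nhds⟩
      by_cases hn : n ∈ Finset.range (N + 1)
      · have hn' := Finset.mem_range_succ_iff.1 hn
        -- As `t k ≤ 1`, every defect is below the translate of `1 - e` by `x`, which serves as
        -- majorant.
        obtain ⟨l, hl⟩ := tendsto_coeff_mixedRatio he hu (N := N - n)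
          (fun k hk => ih k (by omega)) (B := fun w => 1 - e (w - x)) (hu.integrable.comp_sub_right x) n
          (N - n) le_rfl (fun k => defect e (t k) x) t (fun k => (ht k).defect he x) ht
          (fun k w => mul_le_of_le_one_left (hu.nonneg _) ((ht k).le_one w))
          (fun w => by
            obtain ⟨l, hl⟩ := htl w
            exact ⟨_, hl.mul_const _⟩) htl
        exact ⟨_, fun _ => hl.const_mul _⟩
      · exact ⟨0, fun h => absurd h hn⟩
    choose l hl using hp
    refine ⟨∑ n ∈ Finset.range (N + 1), l n, ?_⟩
    simp_rw [coeff_ratioSeries he N (ht _)]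
    exact tendsto_finsetSum _ fun n hn => hl n hn

lemma isRegion_ball {r : ℝ} (hr : 0 < r) : IsRegion (Metric.ball (0 : Space d) r) :=
  ⟨measurableSet_ball, (Metric.measure_ball_pos _ _ hr).ne', measure_ball_lt_top.ne⟩

/-- The infinite-volume limit of the coefficients of the ratios, for arbitrary regions that
contain large balls. -/
theorem exists_limit_coeff_ratioSeries (he : IsPairFactor e) (hu : IsActivity fun x => 1 - e x)
    (n : ℕ) : ∃ l : ℝ, ∀ ε > 0, ∃ R : ℝ, ∀ S : Set (Space d), IsRegion S →
      Metric.ball 0 R ⊆ S →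
      |PowerSeries.coeff n (ratioSeries e (S.indicator fun _ => 1) 0) - l| ≤ ε := by
  have hpt : ∀ S : ℕ → Set (Space d), (∀ k : ℕ, Metric.ball 0 (k : ℝ) ⊆ S k) → ∀ x,
      ∃ l, Tendsto (fun k => (S k).indicator (fun _ => (1 : ℝ)) x) atTop (𝓝 l) := by
    intro S hS x
    refine ⟨1, tendsto_const_nhds.congr' ?_⟩
    obtain ⟨k0, hk0⟩ := exists_nat_gt ‖x‖
    filter_upwards [eventually_ge_atTop k0] with k hk
    have hk' : (k0 : ℝ) ≤ k := Nat.cast_le.2 hk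
    rw [Set.indicator_of_mem (hS k (by simpa using hk0.trans_le hk'))]
  -- The radius is `k + 1` so that `A 0` also has positive volume.
  set A : ℕ → Set (Space d) := fun k => Metric.ball 0 ((k : ℝ) + 1) with hA
  have hAr : ∀ k, IsRegion (A k) := fun k => isRegion_ball (by positivity)
  have hAb : ∀ k : ℕ, Metric.ball 0 (k : ℝ) ⊆ A k := fun k =>
    Metric.ball_subset_ball (by linarith)
  obtain ⟨l, hl⟩ := tendsto_coeff_ratioSeries he hu n (fun k => (A k).indicator fun _ => 1)
    (fun k => isActivity_indicator (hAr k)) (hpt A hAb) 0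
  refine ⟨l, fun ε hε => ?_⟩
  -- Otherwise there is, for each `k`, a bad region containing the ball of radius `k`. Interleaving
  -- bad regions with balls gives a sequence whose coefficients still converge; the even indices
  -- force the limit `l`, while the odd ones stay more than `ε` away from it.
  by_contra! hcon
  choose S hSr hSb hS using fun k : ℕ => hcon k
  set U : ℕ → Set (Space d) := fun k => if Even k then A k else S k with hU
  have hUr : ∀ k, IsRegion (U k) := fun k => by
    simp only [hU]; split_ifs
    · exact hAr k
    · exact hSr k
  have hUb : ∀ k : ℕ, Metric.ball 0 (k : ℝ) ⊆ U k := fun k => by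
    simp only [hU]; split_ifs
    · exact hAb k
    · exact hSb k
  obtain ⟨l', hl'⟩ := tendsto_coeff_ratioSeries he hu n (fun k => (U k).indicator fun _ => 1)
    (fun k => isActivity_indicator (hUr k)) (hpt U hUb) 0
  have heven : Tendsto (fun k : ℕ => 2 * k) atTop atTop :=
    tendsto_atTop_mono (fun k => by simp only [id]; omega) tendsto_id
  have hodd : Tendsto (fun k : ℕ => 2 * k + 1) atTop atTop :=
    tendsto_atTop_mono (fun k => by simp only [id]; omega) tendsto_id
  have h1 : l' = l := by
    refine tendsto_nhds_unique (hl'.comp heven) ((hl.comp heven).congr fun k => ?_)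
    simp [hU]
  have h2 := (hl'.comp hodd).sub_const l
  rw [h1, sub_self] at h2
  obtain ⟨k, hk⟩ := ((h2.abs.eventually_lt_const (by simpa using hε)).exists)
  have h3 := hS (2 * k + 1)
  have h4 : U (2 * k + 1) = S (2 * k + 1) := by
    simp only [hU]; rw [if_neg]; simp
  simp only [Function.comp, h4] at hk
  exact absurd hk h3.not_gt

lemma ratioSeries_translate (t : Space d → ℝ) (x : Space d) :
    ratioSeries e (fun w => t (w + x)) 0 = ratioSeries e t x := by
  have h : ∀ t : Space d → ℝ, partitionSeries e (fun w => t (w + x)) = partitionSeries e t := by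
    intro t; simp only [partitionSeries, configInt_translate]
  rw [ratioSeries, screen_translate, h, h, zero_add, ratioSeries]

/-- The ball is connected and misses the frontier, so it cannot meet both the interior of `Λ` and
the complement of its closure. -/
lemma ball_subset_of_notMem_cthickening {Λ : Set (Space d)} {x : Space d} {R : ℝ} (hx : x ∈ Λ)
    (hxR : x ∉ Metric.cthickening R (frontier Λ)) : Metric.ball x R ⊆ Λ := by
  rcases le_or_gt R 0 with hR | hR
  · rw [Metric.ball_eq_empty.2 hR]; exact Set.empty_subset _
  have hdisj : ∀ y ∈ Metric.ball x R, y ∉ frontier Λ := fun y hy hyf =>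
    hxR (Metric.mem_cthickening_of_dist_le x y R _ hyf (by
      rw [dist_comm]; exact (Metric.mem_ball.1 hy).le))
  intro y hy
  by_contra hyΛ
  obtain ⟨z, -, hz1, hz2⟩ := (convex_ball x R).isPreconnected (interior Λ) (closure Λ)ᶜ
    isOpen_interior isClosed_closure.isOpen_compl
    (fun w hw => by
      by_cases h : w ∈ closure Λ
      · exact Or.inl (by_contra fun h' => hdisj w hw ⟨h, h'⟩)
      · exact Or.inr h)
    ⟨x, Metric.mem_ball_self hR, by_contra fun h' =>
      hdisj x (Metric.mem_ball_self hR) ⟨subset_closure hx, h'⟩⟩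
    ⟨y, hy, fun h => hdisj y hy ⟨h, fun h' => hyΛ (interior_subset h')⟩⟩
  exact hz2 (subset_closure (interior_subset hz1))

lemma IsRegion.preimage_add {Λ : Set (Space d)} (hΛ : IsRegion Λ) (x : Space d) :
    IsRegion ((fun w => w + x) ⁻¹' Λ) := by
  have h := measure_preimage_add_right (volume : Measure (Space d)) x Λ
  exact ⟨(measurable_add_const x) hΛ.measurableSet, h ▸ hΛ.volume_ne_zero, h ▸ hΛ.volume_ne_top⟩

/-- Averages of the coefficients along a van Hove sequence. -/
theorem tendsto_average_logDerivCoeff (he : IsPairFactor e) (hu : IsActivity fun x => 1 - e x)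
    {n : ℕ} {l : ℝ} (hl : ∀ ε > 0, ∃ R : ℝ, ∀ S : Set (Space d), IsRegion S →
      Metric.ball 0 R ⊆ S →
      |PowerSeries.coeff n (ratioSeries e (S.indicator fun _ => 1) 0) - l| ≤ ε)
    {Λ : ℕ → Set (Space d)} (hΛ : IsVanHove Λ) :
    Tendsto (fun k => (volume.real (Λ k))⁻¹ *
      logDerivCoeff e ((Λ k).indicator fun _ => 1) n) atTop (𝓝 l) := by
  rw [Metric.tendsto_nhds]
  intro ε hε
  obtain ⟨R0, hR0⟩ := hl (ε / 2) (half_pos hε)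
  -- The van Hove condition concerns positive distances only.
  set R := max R0 1
  have hR : ∀ S : Set (Space d), IsRegion S → Metric.ball 0 R ⊆ S →
      |PowerSeries.coeff n (ratioSeries e (S.indicator fun _ => 1) 0) - l| ≤ ε / 2 :=
    fun S hS h => hR0 S hS ((Metric.ball_subset_ball (le_max_left _ _)).trans h)
  -- `C` bounds the deviation from `l` at points near the boundary, where nothing better is known.
  set C := treeCoeff (fun n => configInt e n fun x => 1 - e x) n + |l|
  have hC0 : 0 ≤ C := add_nonneg (treeCoeff_nonneg (fun n => configInt_nonneg he n hu) n)
    (abs_nonneg _)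
  set T : ℕ → Set (Space d) := fun k => Metric.cthickening R (frontier (Λ k))
  have hT : ∀ k, MeasurableSet (T k) := fun k => Metric.isClosed_cthickening.measurableSet
  have hρ : Tendsto (fun k => C * (volume (Λ k ∩ T k) / volume (Λ k)).toReal) atTop (𝓝 0) := by
    have h1 : Tendsto (fun k => volume (Λ k ∩ T k) / volume (Λ k)) atTop (𝓝 0) :=
      tendsto_of_tendsto_of_tendsto_of_le_of_le tendsto_const_nhds
        (hΛ.boundary_tendsto R (lt_of_lt_of_le one_pos (le_max_right _ _)))
        (fun _ => zero_le) fun k => ENNReal.div_le_div_right (measure_mono Set.inter_subset_right) _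
    have h2 := ((ENNReal.tendsto_toReal ENNReal.zero_ne_top).comp h1).const_mul C
    simpa using h2
  filter_upwards [hρ.eventually_lt_const (half_pos hε)] with k hk
  have hreg := hΛ.isRegion k
  have ht := isActivity_indicator hreg
  have hv := hreg.volume_real_pos
  set t : Space d → ℝ := (Λ k).indicator fun _ => 1 with htdef
  have hint : ∫ x, t x = volume.real (Λ k) := integral_indicator_region hreg
  have hfin : volume (Λ k ∩ T k) ≠ ⊤ :=
    (measure_mono Set.inter_subset_left).trans_lt hreg.volume_ne_top.lt_top |>.ne
  have hind : Integrable ((Λ k ∩ T k).indicator fun _ => (1 : ℝ)) :=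
    (integrable_indicator_iff (hreg.measurableSet.inter (hT k))).2 (integrableOn_const hfin)
  have hpt : ∀ x, ‖t x * (PowerSeries.coeff n (ratioSeries e t x) - l)‖ ≤
      ε / 2 * t x + C * (Λ k ∩ T k).indicator (fun _ => (1 : ℝ)) x := by
    intro x
    have hnn : 0 ≤ C * (Λ k ∩ T k).indicator (fun _ => (1 : ℝ)) x :=
      mul_nonneg hC0 (Set.indicator_nonneg (fun _ _ => zero_le_one) x)
    by_cases hx : x ∈ Λ k
    · have htx : t x = 1 := Set.indicator_of_mem hx _
      rw [htx, one_mul, mul_one, Real.norm_eq_abs]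
      by_cases hxT : x ∈ T k
      · rw [Set.indicator_of_mem (show x ∈ Λ k ∩ T k from ⟨hx, hxT⟩), mul_one]
        have h3 := coeff_ratioSeries_mem he hu n t ht x
        have h4 : |PowerSeries.coeff n (ratioSeries e t x) - l| ≤ C :=
          (abs_sub _ _).trans (by rw [abs_of_nonneg h3.1]; exact add_le_add_left h3.2 _)
        linarith
      -- Far from the boundary, translating `x` to the origin gives a region containing the ball of
      -- radius `R`.
      · have h5 := hR _ (hreg.preimage_add x) (by
          intro w hw
          refine ball_subset_of_notMem_cthickening hx hxT ?_
          simpa [dist_eq_norm] using hw)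
        have h6 : ((fun w => w + x) ⁻¹' (Λ k)).indicator (fun _ => (1 : ℝ)) =
            fun w => t (w + x) := rfl
        rw [h6, ratioSeries_translate] at h5
        linarith
    · have htx : t x = 0 := Set.indicator_of_notMem hx _
      rw [htx]; simpa using hnn
  have hi := integrable_mul_coeff_ratioSeries he ht n
  have h7 : (volume.real (Λ k))⁻¹ * logDerivCoeff e t n - l = (volume.real (Λ k))⁻¹ *
      ∫ x, t x * (PowerSeries.coeff n (ratioSeries e t x) - l) := by
    simp_rw [mul_sub]
    rw [integral_sub hi (ht.integrable.mul_const l), integral_mul_const, hint, logDerivCoeff]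
    field_simp
  have h8 : ‖∫ x, t x * (PowerSeries.coeff n (ratioSeries e t x) - l)‖ ≤
      ε / 2 * volume.real (Λ k) + C * volume.real (Λ k ∩ T k) := by
    refine (norm_integral_le_of_norm_le ((ht.integrable.const_mul _).add (hind.const_mul _))
      (.of_forall hpt)).trans (le_of_eq ?_)
    simp only [Pi.add_apply]
    rw [integral_add (ht.integrable.const_mul _) (hind.const_mul _), integral_const_mul,
      integral_const_mul, hint, integral_indicator (hreg.measurableSet.inter (hT k))]
    simp
  rw [Real.dist_eq, h7, abs_mul, abs_of_pos (inv_pos.2 hv), inv_mul_lt_iff₀ hv]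
  rw [ENNReal.toReal_div] at hk
  change C * (volume.real (Λ k ∩ T k) / volume.real (Λ k)) < ε / 2 at hk
  rw [← mul_div_assoc, div_lt_iff₀ hv] at hk
  rw [Real.norm_eq_abs] at h8
  linarith

end RepulsiveGas

/-! ### The vertex sum `Ψ`: convexity, maximizer and fixed points. -/

namespace RepulsiveGas
variable {d : ℕ} {β : ℝ} {φ : ℝ → ℝ≥0∞} {e : Space d → ℝ}

/-- A set of finite measure that is almost invariant under a nonzero translation is null. -/
lemma measure_eq_zero_of_translate {D : Set (Space d)} (hD : MeasurableSet D)
    (hfin : volume D ≠ ⊤) {y : Space d} (hy : y ≠ 0)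
    (hinv : (fun w => w - y) ⁻¹' D =ᵐ[volume] D) : volume D = 0 := by
  have hmp : MeasurePreserving (fun w : Space d => w - y) (volume.restrict D)
      (volume.restrict D) := by
    have h := (measurePreserving_sub_right volume y).restrict_preimage hD
    rwa [Measure.restrict_congr_set hinv] at h
  have : IsFiniteMeasure (volume.restrict D) := ⟨by simpa using hfin.lt_top⟩
  -- Poincaré recurrence: a ball of radius `‖y‖ / 2` that meets `D` in positive measure would
  -- contain a point returning to it after `m ≥ 1` steps, but such a point has moved by at least
  -- `‖y‖`.
  have hcons := hmp.conservative
  rw [← Measure.restrict_apply_univ D]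
  refine measure_null_of_locally_null _ fun c _ => ?_
  refine ⟨Metric.ball c (‖y‖ / 2), mem_nhdsWithin_of_mem_nhds
    (Metric.ball_mem_nhds _ (half_pos (norm_pos_iff.2 hy))), ?_⟩
  by_contra hne
  obtain ⟨x, hx, m, hm, hxm⟩ := hcons.exists_mem_iterate_mem measurableSet_ball.nullMeasurableSet hne
  have hit : ∀ m : ℕ, (fun w : Space d => w - y)^[m] x = x - (m : ℝ) • y := by
    intro m
    induction m with
    | zero => simp
    | succ m ih => rw [Function.iterate_succ_apply', ih]; push_cast; rw [add_smul, one_smul]; abel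
  rw [hit] at hxm
  have h1 : dist x (x - (m : ℝ) • y) < ‖y‖ / 2 + ‖y‖ / 2 :=
    (dist_triangle_right _ _ c).trans_lt (add_lt_add hx hxm)
  rw [dist_eq_norm, sub_sub_cancel, norm_smul, add_halves, Real.norm_of_nonneg (Nat.cast_nonneg _)]
    at h1
  have h2 : (1 : ℝ) ≤ m := by exact_mod_cast Nat.one_le_iff_ne_zero.2 hm
  nlinarith [norm_nonneg y]

/-- The second vertex integral of a nontrivial repulsive interaction is positive. -/
theorem configInt_two_pos (hd : 1 ≤ d) (he : IsPairFactor e) (hu : IsActivity fun x => 1 - e x)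
    (hpos : 0 < ∫ x, (1 - e x)) : 0 < configInt e 2 fun x => 1 - e x := by
  set u : Space d → ℝ := fun x => 1 - e x with hudef
  refine lt_of_le_of_ne (configInt_nonneg he 2 hu) fun h0 => ?_
  have : Nonempty (Fin d) := ⟨⟨0, hd⟩⟩
  have hrepr : configInt e 2 u = ∫ y, u y * configInt e 1 (screen e u y) := rfl
  rw [hrepr] at h0
  have hae := (integral_eq_zero_iff_of_nonneg
    (fun y => mul_nonneg (hu.nonneg y) (configInt_nonneg he 1 (hu.screen he y)))
    (integrable_mul_configInt he 1 hu hu)).1 h0.symm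
  set D : Set (Space d) := {x | u x ≠ 0} with hDdef
  set H : Set (Space d) := {x | e x = 0} with hHdef
  have hD : MeasurableSet D := hu.measurable (measurableSet_singleton 0).compl
  have hH : MeasurableSet H := he.measurable (measurableSet_singleton 0)
  have hHD : H ⊆ D := fun x hx => by
    simp only [hHdef, Set.mem_ofPred_eq] at hx
    simp [hDdef, hudef, hx]
  have hDpos : volume D ≠ 0 := by
    intro hD0
    have : u =ᵐ[volume] 0 := by
      rw [Filter.EventuallyEq, ae_iff]; exact hD0
    rw [integral_congr_ae this] at hpos
    simp at hpos
  have hHfin : volume H ≠ ⊤ := by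
    have h1 := hu.integrable.measure_norm_ge_lt_top (ε := 1) one_pos
    refine ((measure_mono fun x hx => ?_).trans_lt h1).ne
    simp only [hHdef, Set.mem_ofPred_eq] at hx
    simp [hudef, hx]
  -- `D` has positive measure, and for `d ≥ 1` a single point is null, so `y` can be taken nonzero.
  obtain ⟨y, hyD, hy0, hy⟩ : ∃ y, y ∈ D ∧ y ≠ 0 ∧ u y * configInt e 1 (screen e u y) = 0 := by
    by_contra! hcon
    refine hDpos (measure_mono_null (t := {0} ∪ {y | ¬ u y * configInt e 1 (screen e u y) = 0})
      (fun y hyD => ?_) (measure_union_null (measure_singleton 0) (ae_iff.1 hae)))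
    by_cases hy0 : y = 0
    · exact Or.inl hy0
    · exact Or.inr (hcon y hyD hy0)
  have hint : ∫ w, screen e u y w = 0 := by
    have h1 := (mul_eq_zero.1 hy).resolve_left hyD
    simpa [configInt] using h1
  have hae2 := (integral_eq_zero_iff_of_nonneg (hu.screen he y).nonneg
    (hu.screen he y).integrable).1 hint
  -- Up to null sets `D` lies in the translate of `H` by `y`. As `u = 1` on `H`, the set `H` has
  -- finite measure, hence so has `D`; since `H ⊆ D`, the set `D` lies in its own translate, of the
  -- same finite measure, and so coincides with it almost everywhere.
  have hsub : D ≤ᵐ[volume] (fun w => w - y) ⁻¹' H := by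
    filter_upwards [hae2] with w hw hwD
    exact (mul_eq_zero.1 hw).resolve_left hwD
  have hsub' : D ≤ᵐ[volume] (fun w => w - y) ⁻¹' D :=
    hsub.trans (.of_forall fun w hw => hHD hw)
  have hpre : ∀ S : Set (Space d), volume ((fun w => w - y) ⁻¹' S) = volume S := fun S =>
    by simpa only [sub_eq_add_neg] using measure_preimage_add_right (volume : Measure (Space d)) (-y) S
  have hDfin : volume D ≠ ⊤ :=
    ((measure_mono_ae hsub).trans_lt (by rw [hpre]; exact hHfin.lt_top)).ne
  have hinv := ae_eq_of_ae_subset_of_measure_ge hsub' (hpre D).le hD.nullMeasurableSet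
    (by rw [hpre]; exact hDfin)
  exact hDpos (measure_eq_zero_of_translate hD hDfin hy0 hinv.symm)

/-- The terms of the vertex sum. -/
noncomputable def vertexTerm (d : ℕ) (β : ℝ) (φ : ℝ → ℝ≥0∞) (μ : ℝ) (n : ℕ) : ℝ :=
  μ ^ n / (n.factorial : ℝ) * configInt (pairFactor d β φ) n fun x => 1 - pairFactor d β φ x

lemma vertexTerm_nonneg (hβ : 0 < β) (hφ : Measurable φ) (hC : temperConst d β φ ≠ ⊤) {μ : ℝ}
    (hμ : 0 ≤ μ) (n : ℕ) : 0 ≤ vertexTerm d β φ μ n :=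
  mul_nonneg (by positivity) (configInt_nonneg (isPairFactor_pairFactor hβ hφ) n
    (isActivity_one_sub_pairFactor hβ hφ hC))

lemma norm_vertexTerm_le (hβ : 0 < β) (hφ : Measurable φ) (hC : temperConst d β φ ≠ ⊤) {μ R : ℝ}
    (hμ : |μ| ≤ R) (n : ℕ) : ‖vertexTerm d β φ μ n‖ ≤
      (R * ∫ x, (1 - pairFactor d β φ x)) ^ n / (n.factorial : ℝ) := by
  have he := isPairFactor_pairFactor (d := d) hβ hφ
  have hu := isActivity_one_sub_pairFactor (d := d) hβ hφ hC
  have h1 := configInt_le he n hu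
  have h0 := configInt_nonneg he n hu
  rw [vertexTerm, norm_mul, norm_div, norm_pow, Real.norm_eq_abs, Real.norm_of_nonneg h0,
    Real.norm_of_nonneg (Nat.cast_nonneg _), mul_pow]
  have hR : 0 ≤ R := (abs_nonneg _).trans hμ
  calc _ ≤ R ^ n / (n.factorial : ℝ) * (∫ x, (1 - pairFactor d β φ x)) ^ n := by gcongr
    _ = _ := by ring

lemma summable_vertexTerm (hβ : 0 < β) (hφ : Measurable φ) (hC : temperConst d β φ ≠ ⊤) (μ : ℝ) :
    Summable (vertexTerm d β φ μ) :=
  Summable.of_norm_bounded (Real.summable_pow_div_factorial _)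
    (norm_vertexTerm_le hβ hφ hC le_rfl)

lemma vertexSum_eq (hβ : 0 < β) (hφ : Measurable φ) (hC : temperConst d β φ ≠ ⊤) (μ : ℝ) :
    vertexSum d β φ μ = ∑' n, vertexTerm d β φ μ n := by
  rw [(summable_vertexTerm hβ hφ hC μ).tsum_eq_zero_add, vertexSum]
  simp only [vertexIntegral_eq hβ hφ hC]
  simp [vertexTerm, configInt]

lemma continuous_vertexSum (hβ : 0 < β) (hφ : Measurable φ) (hC : temperConst d β φ ≠ ⊤) :
    Continuous (vertexSum d β φ) := by
  rw [continuous_iff_continuousAt]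
  intro μ
  have h : ContinuousOn (vertexSum d β φ) (Metric.closedBall 0 (|μ| + 1)) := by
    refine (continuousOn_tsum (f := fun n μ => vertexTerm d β φ μ n)
      (fun n => ?_) (Real.summable_pow_div_factorial _)
      fun n x hx => norm_vertexTerm_le hβ hφ hC (by simpa using hx) n).congr
      fun x _ => vertexSum_eq hβ hφ hC x
    unfold vertexTerm
    fun_prop
  refine h.continuousAt (Filter.mem_of_superset (Metric.ball_mem_nhds μ one_pos) fun x hx => ?_)
  rw [Metric.mem_ball, Real.dist_eq] at hx
  rw [mem_closedBall_zero_iff, Real.norm_eq_abs]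
  linarith [abs_sub_abs_le_abs_sub x μ]

lemma vertexSum_zero : vertexSum d β φ 0 = 1 := by simp [vertexSum]

lemma integral_one_sub_pairFactor_pos (hβ : 0 < β) (hφ : Measurable φ)
    (hC : temperConst d β φ ≠ ⊤) (hC0 : temperConst d β φ ≠ 0) :
    0 < ∫ x : Space d, (1 - pairFactor d β φ x) := by
  have hu := isActivity_one_sub_pairFactor (d := d) hβ hφ hC
  rw [integral_eq_lintegral_of_nonneg_ae (.of_forall hu.nonneg) hu.measurable.aestronglyMeasurable]
  have h : ∫⁻ x : Space d, ENNReal.ofReal (1 - pairFactor d β φ x) = temperConst d β φ := by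
    refine lintegral_congr fun x => ?_
    rw [abs_sub_comm, abs_of_nonneg (sub_nonneg.2 (boltzmann_le_one hβ _))]; rfl
  rw [h]
  exact ENNReal.toReal_pos hC0 hC

lemma sum_vertexTerm_le (hβ : 0 < β) (hφ : Measurable φ) (hC : temperConst d β φ ≠ ⊤) {μ : ℝ}
    (hμ : 0 ≤ μ) (s : Finset ℕ) : ∑ n ∈ s, vertexTerm d β φ μ n ≤ vertexSum d β φ μ := by
  rw [vertexSum_eq hβ hφ hC]
  exact (summable_vertexTerm hβ hφ hC μ).sum_le_tsum s
    fun n _ => vertexTerm_nonneg hβ hφ hC hμ n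

lemma one_le_vertexSum (hβ : 0 < β) (hφ : Measurable φ) (hC : temperConst d β φ ≠ ⊤) {μ : ℝ}
    (hμ : 0 ≤ μ) : 1 ≤ vertexSum d β φ μ := by
  have h := sum_vertexTerm_le (d := d) hβ hφ hC hμ {0}
  simpa [vertexTerm, configInt] using h

/-- Every term is convex on `[0, ∞)` because its coefficient is nonnegative; the quadratic one is
strictly convex because `g(2) > 0`. -/
lemma vertexSum_midpoint_lt (hd : 1 ≤ d) (hβ : 0 < β) (hφ : Measurable φ)
    (hC : temperConst d β φ ≠ ⊤) (hC0 : temperConst d β φ ≠ 0) {a b : ℝ} (ha : 0 ≤ a) (hab : a < b) :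
    vertexSum d β φ ((a + b) / 2) < (vertexSum d β φ a + vertexSum d β φ b) / 2 := by
  have he := isPairFactor_pairFactor (d := d) hβ hφ
  have hu := isActivity_one_sub_pairFactor (d := d) hβ hφ hC
  have hsa := summable_vertexTerm (d := d) hβ hφ hC a
  have hsb := summable_vertexTerm (d := d) hβ hφ hC b
  simp only [vertexSum_eq hβ hφ hC]
  rw [← hsa.tsum_add hsb, ← tsum_div_const]
  have hterm : ∀ n, (vertexTerm d β φ a n + vertexTerm d β φ b n) / 2 =
      ((a ^ n + b ^ n) / 2) / (n.factorial : ℝ) *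
        configInt (pairFactor d β φ) n fun x => 1 - pairFactor d β φ x := fun n => by
    rw [vertexTerm, vertexTerm]; ring
  refine Summable.tsum_lt_tsum (i := 2) (fun n => ?_) ?_ (summable_vertexTerm hβ hφ hC _)
    ((hsa.add hsb).div_const 2)
  · rw [hterm, vertexTerm]
    refine mul_le_mul_of_nonneg_right (div_le_div_of_nonneg_right ?_ (Nat.cast_nonneg _))
      (configInt_nonneg he n hu)
    have h := (convexOn_pow n).2 (Set.mem_Ici.2 ha) (Set.mem_Ici.2 (ha.trans hab.le))
      (by norm_num : (0 : ℝ) ≤ 1 / 2) (by norm_num : (0 : ℝ) ≤ 1 / 2) (by norm_num)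
    simp only [smul_eq_mul] at h
    calc ((a + b) / 2) ^ n = (1 / 2 * a + 1 / 2 * b) ^ n := by ring
      _ ≤ _ := h
      _ = _ := by ring
  · rw [hterm, vertexTerm]
    refine mul_lt_mul_of_pos_right (div_lt_div_of_pos_right ?_ (by positivity))
      (configInt_two_pos hd he hu (integral_one_sub_pairFactor_pos hβ hφ hC hC0))
    nlinarith [mul_pos (sub_pos.2 hab) (sub_pos.2 hab)]

lemma IsArgmax.pos (hβ : 0 < β) (hφ : Measurable φ) (hC : temperConst d β φ ≠ ⊤) {m : ℝ}
    (hm : IsArgmax d β φ m) : 0 < m := by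
  refine lt_of_le_of_ne hm.1 fun h => ?_
  have h1 := hm.2 1 zero_le_one
  rw [← h, zero_div] at h1
  exact absurd h1 (not_le.2 (div_pos one_pos
    (one_pos.trans_le (one_le_vertexSum hβ hφ hC zero_le_one))))

/-- The maximum of `μ / Ψ(μ)` is attained at exactly one point. -/
theorem existsUnique_isArgmax (hd : 1 ≤ d) (hβ : 0 < β) (hφ : Measurable φ)
    (hC : temperConst d β φ ≠ ⊤) (hC0 : temperConst d β φ ≠ 0) : ∃! m, IsArgmax d β φ m := by
  have hge : ∀ {μ : ℝ}, 0 ≤ μ → 0 < vertexSum d β φ μ := fun hμ =>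
    one_pos.trans_le (one_le_vertexSum hβ hφ hC hμ)
  have hex : ∃ m, IsArgmax d β φ m := by
    set c := (configInt (pairFactor d β φ) 2 fun x => 1 - pairFactor d β φ x) / 2 with hcdef
    have hc : 0 < c := half_pos (configInt_two_pos hd (isPairFactor_pairFactor hβ hφ)
      (isActivity_one_sub_pairFactor hβ hφ hC) (integral_one_sub_pairFactor_pos hβ hφ hC hC0))
    have hquad : ∀ {μ : ℝ}, 0 ≤ μ → c * μ ^ 2 ≤ vertexSum d β φ μ := fun {μ} hμ => by
      have h := sum_vertexTerm_le (d := d) hβ hφ hC hμ {2}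
      rw [Finset.sum_singleton, vertexTerm] at h
      refine le_trans (le_of_eq ?_) h
      rw [hcdef]; simp only [Nat.factorial]; push_cast; ring
    set h1 := 1 / vertexSum d β φ 1
    have hh1 : 0 < h1 := div_pos one_pos (hge zero_le_one)
    -- Beyond `K` the bound `Ψ(μ) ≥ c μ ^ 2` pushes `μ / Ψ(μ)` below its value `h1` at `1`, so the
    -- maximum over `[0, K]` is global.
    set K := max 1 (1 / (c * h1))
    have hcont : ContinuousOn (fun μ => μ / vertexSum d β φ μ) (Set.Icc 0 K) :=
      continuousOn_id.div (continuous_vertexSum hβ hφ hC).continuousOn fun μ hμ => (hge hμ.1).ne'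
    obtain ⟨m, hm, hmax⟩ := isCompact_Icc.exists_isMaxOn
      (Set.nonempty_Icc.2 (zero_le_one.trans (le_max_left _ _))) hcont
    refine ⟨m, hm.1, fun μ hμ => ?_⟩
    rcases le_or_gt μ K with hμK | hμK
    · exact hmax ⟨hμ, hμK⟩
    · have hm1 : h1 ≤ m / vertexSum d β φ m := hmax ⟨zero_le_one, le_max_left _ _⟩
      refine le_trans ?_ hm1
      have hμ0 : 0 < μ := lt_of_lt_of_le one_pos ((le_max_left _ _).trans hμK.le)
      have h2 : 1 / (c * h1) ≤ μ := (le_max_right _ _).trans hμK.le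
      rw [div_le_iff₀ (mul_pos hc hh1)] at h2
      rw [div_le_iff₀ (hge hμ)]
      calc μ ≤ μ * (μ * (c * h1)) := le_mul_of_one_le_right hμ h2
        _ = h1 * (c * μ ^ 2) := by ring
        _ ≤ _ := mul_le_mul_of_nonneg_left (hquad hμ) hh1.le
  -- At two maximizers `r Ψ(μ) = μ` with the same `r`; strict convexity gives `r Ψ < μ` at the
  -- midpoint, a larger quotient than the maximum.
  have key : ∀ a b, IsArgmax d β φ a → IsArgmax d β φ b → ¬ a < b := by
    intro a b ha hb hab
    set r := a / vertexSum d β φ a with hr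
    have hrb : r = b / vertexSum d β φ b := le_antisymm (hb.2 a ha.1) (ha.2 b hb.1)
    have hr0 : 0 < r := div_pos (ha.pos hβ hφ hC) (hge ha.1)
    have h1 : r * vertexSum d β φ a = a := div_mul_cancel₀ _ (hge ha.1).ne'
    have h2 : r * vertexSum d β φ b = b := by rw [hrb]; exact div_mul_cancel₀ _ (hge hb.1).ne'
    have hmid0 : 0 ≤ (a + b) / 2 := by linarith [ha.1, hb.1]
    have h3 := ha.2 ((a + b) / 2) hmid0
    rw [div_le_iff₀ (hge hmid0), ← hr] at h3
    have h4 := mul_lt_mul_of_pos_left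
      (vertexSum_midpoint_lt hd hβ hφ hC hC0 ha.1 hab) hr0
    linarith
  obtain ⟨m, hm⟩ := hex
  exact ⟨m, hm, fun b hb => le_antisymm (not_lt.1 (key m b hm hb)) (not_lt.1 (key b m hb hm))⟩

/-- The fixed point equation `|z| Ψ(μ) = μ` has a smallest solution when `|z| Ψ(μ) ≤ μ` for
some `μ`. -/
theorem exists_isSmallestFixedPoint (hβ : 0 < β) (hφ : Measurable φ) (hC : temperConst d β φ ≠ ⊤)
    {z : ℂ} {m : ℝ} (hm : 0 ≤ m) (h : ‖z‖ * vertexSum d β φ m ≤ m) :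
    ∃ μ, IsSmallestFixedPoint d β φ z μ := by
  have hcont := continuous_vertexSum (d := d) hβ hφ hC
  -- This function is `‖z‖ ≥ 0` at `0` and at most `0` at `m`, so it has a zero; its zeros in `[0,
  -- ∞)` form a closed set, which contains its infimum.
  have hF : Continuous fun μ => ‖z‖ * vertexSum d β φ μ - μ := (hcont.const_mul _).sub continuous_id
  obtain ⟨μ, hμ, hμ0⟩ := intermediate_value_Icc' hm hF.continuousOn
    (⟨sub_nonpos.2 h, by simp [vertexSum_zero]⟩ : (0 : ℝ) ∈ Set.Icc _ _)
  have hclosed : IsClosed {μ : ℝ | 0 ≤ μ ∧ ‖z‖ * vertexSum d β φ μ = μ} :=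
    (isClosed_le continuous_const continuous_id).inter
      (isClosed_eq (hcont.const_mul _) continuous_id)
  have hbdd : BddBelow {μ : ℝ | 0 ≤ μ ∧ ‖z‖ * vertexSum d β φ μ = μ} := ⟨0, fun _ h => h.1⟩
  exact ⟨_, hclosed.csInf_mem ⟨μ, hμ.1, sub_eq_zero.1 hμ0⟩ hbdd, fun _ hx => csInf_le hbdd hx⟩

/-- Partial sums of the dominating series at a radius `r` with `r Ψ(μ) ≤ μ`. -/
theorem sum_gasTreeCoeff_le (hβ : 0 < β) (hφ : Measurable φ) (hC : temperConst d β φ ≠ ⊤)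
    {r μ : ℝ} (hr : 0 ≤ r) (hμ : 0 ≤ μ) (h : r * vertexSum d β φ μ ≤ μ) (N : ℕ) :
    ∑ n ∈ Finset.range N, gasTreeCoeff d β φ n * r ^ (n + 1) ≤ μ :=
  sum_treeCoeff_le (fun n => configInt_nonneg (isPairFactor_pairFactor hβ hφ) n
    (isActivity_one_sub_pairFactor hβ hφ hC)) hr hμ
    (fun N => (mul_le_mul_of_nonneg_left
      (sum_vertexTerm_le hβ hφ hC hμ (Finset.range N)) hr).trans h) N

end RepulsiveGas

/-! ### Passage to the infinite-volume series and conclusion. -/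

namespace RepulsiveGas
variable {d : ℕ} {β : ℝ} {φ : ℝ → ℝ≥0∞}

/-- The Taylor coefficients of the derivative of the infinite-volume pressure: the limits of the
finite-volume ones along van Hove sequences. -/
theorem exists_limit_pressureDerivCoeff (hβ : 0 < β) (hφ : Measurable φ)
    (hC : temperConst d β φ ≠ ⊤) : ∃ c : ℕ → ℂ, (∀ n, ‖c n‖ ≤ gasTreeCoeff d β φ n) ∧
      ∀ Λ : ℕ → Set (Space d), IsVanHove Λ →
        ∀ n, Tendsto (fun k => pressureDerivCoeff β φ (Λ k) n) atTop (𝓝 (c n)) := by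
  have he := isPairFactor_pairFactor (d := d) hβ hφ
  have hu := isActivity_one_sub_pairFactor (d := d) hβ hφ hC
  choose l hl using exists_limit_coeff_ratioSeries he hu
  refine ⟨fun n => (((-1) ^ n * l n : ℝ) : ℂ), fun n => ?_, fun Λ hΛ n => ?_⟩
  · rw [Complex.norm_real, Real.norm_eq_abs, abs_mul, abs_pow, abs_neg, abs_one, one_pow, one_mul]
    -- A large ball has a coefficient within `ε` of `l n`, and that coefficient lies between `0` and
    -- the tree coefficient.
    refine le_of_forall_pos_le_add fun ε hε => ?_
    obtain ⟨R, hR⟩ := hl n ε hε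
    have hreg : IsRegion (Metric.ball (0 : Space d) (max R 1)) :=
      isRegion_ball (lt_of_lt_of_le one_pos (le_max_right _ _))
    have h1 := hR _ hreg (Metric.ball_subset_ball (le_max_left _ _))
    have h2 := coeff_ratioSeries_mem he hu n _ (isActivity_indicator hreg) 0
    have h3 : PowerSeries.coeff n (ratioSeries (pairFactor d β φ)
      ((Metric.ball (0 : Space d) (max R 1)).indicator fun _ => 1) 0) ≤ gasTreeCoeff d β φ n := h2.2
    rw [abs_le] at h1 ⊢
    constructor <;> linarith [h2.1]
  · have h := (tendsto_average_logDerivCoeff he hu (hl n) hΛ).const_mul ((-1) ^ n)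
    exact (Complex.continuous_ofReal.tendsto _).comp h

/-- Dominated convergence for series; as the majorant is summable at `r` itself, the circle `|z| =
r` is included. -/
lemma tendsto_primitiveSeries {c : ℕ → ℕ → ℂ} {c' : ℕ → ℂ} {m : ℕ → ℝ} {r : ℝ} {z : ℂ}
    (hc : ∀ n, Tendsto (fun k => c k n) atTop (𝓝 (c' n))) (hcm : ∀ k n, ‖c k n‖ ≤ m n)
    (hm : Summable fun n => m n * r ^ n) (hz : ‖z‖ ≤ r) :
    Tendsto (fun k => primitiveSeries (c k) z) atTop (𝓝 (primitiveSeries c' z)) := by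
  have hr : 0 ≤ r := (norm_nonneg z).trans hz
  refine tendsto_tsum_of_dominated_convergence (bound := fun n => m n * r ^ (n + 1)) ?_
    (fun n => ((hc n).div_const _).mul_const _) (.of_forall fun k n => ?_)
  · refine (hm.mul_left r).congr fun n => ?_
    rw [pow_succ]; ring
  · exact (norm_primitive_term_le _ hz n).trans
      (mul_le_mul_of_nonneg_right (hcm k n) (pow_nonneg hr _))

end RepulsiveGas

theorem mainTheorem6 (d : ℕ) (hd : 1 ≤ d) (β : ℝ) (hβ : 0 < β)
    (φ : ℝ → ℝ≥0∞) (hφ : Measurable φ)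
    (hC : RepulsiveGas.temperConst d β φ ≠ ⊤) (hC0 : RepulsiveGas.temperConst d β φ ≠ 0) :
    -- the maximum of `μ / Ψ(μ)` is attained, at exactly one point `μ*`
    (∃! m : ℝ, RepulsiveGas.IsArgmax d β φ m) ∧
    ∀ (μstar rstar : ℝ), RepulsiveGas.IsArgmax d β φ μstar →
      rstar = μstar / RepulsiveGas.vertexSum d β φ μstar →
      -- `P Λ z` is `β P_Λ(z)`, `p z` is `β p(z)`, `b n` is the infinite-volume coefficient
      ∃ (P : Set (RepulsiveGas.Space d) → ℂ → ℂ) (p : ℂ → ℂ) (b : ℕ → ℂ),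
        (∀ Λ : Set (RepulsiveGas.Space d), RepulsiveGas.IsRegion Λ → RepulsiveGas.IsFinitePressure β φ Λ rstar (P Λ)) ∧
        (∀ Λ : ℕ → Set (RepulsiveGas.Space d), RepulsiveGas.IsVanHove Λ →
          (∀ n, Tendsto (fun k => RepulsiveGas.clusterCoeff β φ (Λ k) n) atTop (𝓝 (b n))) ∧
          ∀ z : ℂ, ‖z‖ ≤ rstar → Tendsto (fun k => P (Λ k) z) atTop (𝓝 (p z))) ∧
        -- (i) radii of convergence of the finite- and infinite-volume cluster expansions,
        -- and their sums
        (∀ Λ : Set (RepulsiveGas.Space d), RepulsiveGas.IsRegion Λ →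
          ENNReal.ofReal rstar ≤
            RepulsiveGas.expansionRadius (RepulsiveGas.clusterCoeff β φ Λ)) ∧
        ENNReal.ofReal rstar ≤ RepulsiveGas.expansionRadius b ∧
        (∀ z : ℂ, ‖z‖ ≤ rstar →
          (∀ Λ : Set (RepulsiveGas.Space d), RepulsiveGas.IsRegion Λ →
            HasSum (fun n : ℕ => RepulsiveGas.clusterCoeff β φ Λ (n + 1) /
              ((n + 1).factorial : ℂ) * z ^ (n + 1)) (P Λ z)) ∧
          HasSum (fun n : ℕ => b (n + 1) / ((n + 1).factorial : ℂ) * z ^ (n + 1)) (p z)) ∧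
        -- (ii) uniform bounds
        (∀ z : ℂ, ‖z‖ ≤ rstar →
          (∀ Λ : Set (RepulsiveGas.Space d), RepulsiveGas.IsRegion Λ → ‖P Λ z‖ ≤ μstar) ∧ ‖p z‖ ≤ μstar) ∧
        -- (iii) bounds by the smallest fixed point
        (∀ z : ℂ, ‖z‖ ≤ rstar →
          ∃ μz : ℝ, RepulsiveGas.IsSmallestFixedPoint d β φ z μz ∧
            (∀ Λ : Set (RepulsiveGas.Space d), RepulsiveGas.IsRegion Λ → ‖P Λ z‖ ≤ μz) ∧ ‖p z‖ ≤ μz) := by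
  refine ⟨RepulsiveGas.existsUnique_isArgmax hd hβ hφ hC hC0, fun μstar rstar hμ hr => ?_⟩
  have hμ0 := hμ.pos hβ hφ hC
  have hΨ : 0 < RepulsiveGas.vertexSum d β φ μstar :=
    one_pos.trans_le (RepulsiveGas.one_le_vertexSum hβ hφ hC hμ0.le)
  have hr0 : 0 < rstar := hr ▸ div_pos hμ0 hΨ
  have hfix : rstar * RepulsiveGas.vertexSum d β φ μstar = μstar := by
    rw [hr]; exact div_mul_cancel₀ _ hΨ.ne'
  have hsum : Summable fun n => RepulsiveGas.gasTreeCoeff d β φ n * rstar ^ n :=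
    RepulsiveGas.summable_of_sum_mul_pow_succ_le (RepulsiveGas.gasTreeCoeff_nonneg hβ hφ hC) hr0
      (RepulsiveGas.sum_gasTreeCoeff_le hβ hφ hC hr0.le hμ0.le hfix.le)
  obtain ⟨c, hcm, hclim⟩ := RepulsiveGas.exists_limit_pressureDerivCoeff (d := d) hβ hφ hC
  have hcs : Summable fun n => ‖c n‖ * rstar ^ n :=
    hsum.of_nonneg_of_le (fun n => by positivity) fun n =>
      mul_le_mul_of_nonneg_right (hcm n) (by positivity)
  set b : ℕ → ℂ := fun n => (n.factorial : ℂ) * (if n = 0 then 0 else c (n - 1) / (n : ℂ)) with hb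
  have hbs : ∀ n : ℕ, b (n + 1) / ((n + 1).factorial : ℂ) = c n / ((n : ℂ) + 1) := by
    intro n
    have hf : ((n + 1).factorial : ℂ) ≠ 0 := by exact_mod_cast Nat.factorial_ne_zero _
    rw [hb]
    simp only [mul_div_cancel_left₀ _ hf]
    simp
  have hle : ∀ {z : ℂ}, ‖z‖ ≤ rstar → ‖z‖ * RepulsiveGas.vertexSum d β φ μstar ≤ μstar :=
    fun hz => (mul_le_mul_of_nonneg_right hz hΨ.le).trans hfix.le
  -- Any `μ ≥ 0` with `|z| Ψ(μ) ≤ μ` bounds the pressures; it is applied with `μ*` for (ii) and with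
  -- the smallest fixed point for (iii).
  have hbound : ∀ {z : ℂ} {μ : ℝ}, 0 ≤ μ → ‖z‖ * RepulsiveGas.vertexSum d β φ μ ≤ μ →
      (∀ Λ : Set (RepulsiveGas.Space d), RepulsiveGas.IsRegion Λ →
        ‖RepulsiveGas.pressure β φ Λ z‖ ≤ μ) ∧ ‖RepulsiveGas.primitiveSeries c z‖ ≤ μ := by
    intro z μ h0 h
    have hs := RepulsiveGas.sum_gasTreeCoeff_le hβ hφ hC (norm_nonneg z) h0 h
    exact ⟨fun Λ hΛ => RepulsiveGas.norm_primitiveSeries_le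
      (RepulsiveGas.norm_pressureDerivCoeff_le hβ hφ hC hΛ) hs,
      RepulsiveGas.norm_primitiveSeries_le hcm hs⟩
  refine ⟨RepulsiveGas.pressure β φ, RepulsiveGas.primitiveSeries c, b,
    fun Λ hΛ => RepulsiveGas.isFinitePressure_pressure hβ hφ hC hΛ hr0 hsum,
    fun Λ hΛ => ⟨fun n => ?_, fun z hz => ?_⟩, fun Λ hΛ => ?_, ?_, fun z hz => ⟨fun Λ hΛ => ?_, ?_⟩,
    fun z hz => hbound hμ0.le (hle hz), fun z hz => ?_⟩
  · simp_rw [RepulsiveGas.clusterCoeff_eq hβ hφ hC (hΛ.isRegion _) hr0 hsum]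
    refine Tendsto.const_mul _ ?_
    split_ifs with hn
    · exact tendsto_const_nhds
    · exact (hclim Λ hΛ (n - 1)).div_const _
  · exact RepulsiveGas.tendsto_primitiveSeries (hclim Λ hΛ)
      (fun k => RepulsiveGas.norm_pressureDerivCoeff_le hβ hφ hC (hΛ.isRegion k)) hsum hz
  · exact RepulsiveGas.le_expansionRadius hr0
      (RepulsiveGas.summable_pressureDerivCoeff hβ hφ hC hΛ hr0 hsum)
      (RepulsiveGas.clusterCoeff_succ_div hβ hφ hC hΛ hr0 hsum)
  · exact RepulsiveGas.le_expansionRadius hr0 hcs hbs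
  · simp_rw [RepulsiveGas.clusterCoeff_succ_div hβ hφ hC hΛ hr0 hsum]
    exact (RepulsiveGas.summable_primitive
      (RepulsiveGas.summable_pressureDerivCoeff hβ hφ hC hΛ hr0 hsum) hz).hasSum
  · simp_rw [hbs]
    exact (RepulsiveGas.summable_primitive hcs hz).hasSum
  · obtain ⟨μz, hμz⟩ := RepulsiveGas.exists_isSmallestFixedPoint hβ hφ hC hμ0.le (hle hz)
    exact ⟨μz, hμz, hbound hμz.1.1 hμz.1.2.le⟩
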